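/- **Setting.** Let $\mathcal S,\mathcal A$ be finite non-empty sets with $S=|\mathcal S|$, $A=|\mathcal A|$, let $H\ge1$ be an integer, and consider an episodic MDP with transition kernels $P_h(\cdot\mid s,a)$ and deterministic rewards $r_h(s,a)\in[0,1]$, $h\in[H]=\{1,\dots,H\}$. For a risk parameter $\beta\neq0$ and a policy $\pi=(\pi_h)_{h\in[H]}$, $\pi_h:\mathcal S\to\mathcal A$, put $$V_h^\pi(s)=\frac1\beta\log\mathbb E\Big[\exp\Big(\beta\sum_{i=h}^{H}r_i(s_i,\pi_i(s_i))\Big)\,\Big|\,s_h=s\Big],\qquad V_h^*(s)=\sup_\pi V_h^\pi(s),$$ where $s_{i+1}\sim P_i(\cdot\mid s_i,\pi_i(s_i))$. Let $K$ be the number of episodes, $T=KH$, $\delta\in(0,1]$, $\alpha_t=\frac{H+1}{H+t}$, and $b_t=c\,|e^{\beta H}-1|\sqrt{H\log(SAT/\delta)/t}$. **Algorithm RSQ** (risk-sensitive Q-learning with bonus constant $c$). Initialize $Q_h(s,a)=V_h(s)=H-h+1$ and $N_h(s,a)=0$ for $h\in[H]$, and $Q_{H+1}=V_{H+1}=0$.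 In each episode $k=1,\dots,K$ the environment chooses the initial state $s_1$ arbitrarily (possibly at random and depending on the past episodes); then, for $h=1,\dots,H$, the agent takes $a_h\in\arg\max_{a'}Q_h(s_h,a')$ (ties broken arbitrarily), observes $r_h(s_h,a_h)$ and $s_{h+1}\sim P_h(\cdot\mid s_h,a_h)$, increases $N_h(s_h,a_h)$ by one, sets $t=N_h(s_h,a_h)$ and $$w=(1-\alpha_t)e^{\beta Q_h(s_h,a_h)}+\alpha_te^{\beta[r_h(s_h,a_h)+V_{h+1}(s_{h+1})]},$$ $$Q_h(s_h,a_h)\leftarrow\begin{cases}\frac1\beta\log\min\{e^{\beta(H-h+1)},\,w+\alpha_tb_t\},&\beta>0,\\[2pt]\frac1\beta\log\max\{e^{\beta(H-h+1)},\,w-\alpha_tb_t\},&\beta<0,\end{cases}\qquad V_h(s_h)\leftarrow\max_{a'}Q_h(s_h,a').$$ Let $s_1^k$ be the initial state of episode $k$ and $\pi^k$ the policy that is greedy with respect to the estimates $Q$ at the beginning of episode $k$, with the same tie-breaking. Put $$\mathrm{Regret}(K)=\sum_{k=1}^{K}\big[V_1^*(s_1^k)-V_1^{\pi^k}(s_1^k)\big],\qquad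 \lambda(u)=\frac{e^{3u}-1}{u}.$$ **Theorem.** There is a universal constant $c_0>0$ such that for every bonus constant $c\ge c_0$ there is a constant $C>0$, depending only on $c$, with the following property. For every MDP as above, every $\beta\ne0$ and every $\delta\in(0,1]$ there is a threshold $T_0$ (depending on the MDP, $\beta$, $\delta$ and $c$ only) such that for every $K$ with $T=KH\ge T_0$, for every choice of the initial states by the environment and every tie-breaking rule, with probability at least $1-\delta$, $$\mathrm{Regret}(K)\le C\,\lambda(|\beta|H^2)\sqrt{H^4SAT\log(SAT/\delta)}.$$ -/

import Mathlib

noncomputable section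

namespace RSQ

/-- An episodic MDP with state space `S`, action space `A` and horizon `H`. Steps are numbered
`1, …, H`; the data at other steps is never used. The rewards are deterministic and lie in
`[0, 1]`, the transition kernels are arbitrary. -/
structure MDP (S A : Type*) (H : ℕ) where
  /-- `P h s a` is the law of the next state when action `a` is taken in state `s` at step `h`. -/
  P : ℕ → S → A → PMF S
  /-- `r h s a` is the reward of action `a` in state `s` at step `h`. -/
  r : ℕ → S → A → ℝ
  r_mem : ∀ h ∈ Finset.Icc 1 H, ∀ s a, r h s a ∈ Set.Icc (0 : ℝ) 1

/-- A (deterministic, step dependent) policy: `π h s` is the action taken in `s` at step `h`. -/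
abbrev Policy (S A : Type*) := ℕ → S → A

/-- Expectation of a real function under a discrete law. It is only applied to laws with finite
support. -/
def expect {X : Type*} (p : PMF X) (f : X → ℝ) : ℝ := ∑' x, (p x).toReal * f x

section Values

variable {S A : Type*} {H : ℕ}

/-- The law of the state trajectory under policy `π`, started in `s` at step `h` and run for `n`
transitions: `τ i` is the state at step `i`, for `h ≤ i ≤ h + n` (other entries are irrelevant). -/
def MDP.trajLaw (M : MDP S A H) (π : Policy S A) : ℕ → ℕ → S → PMF (ℕ → S)
  | 0, _, s => PMF.pure fun _ => s
  | n + 1, h, s => (M.P h s (π h s)).bind fun s' =>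
      (M.trajLaw π n (h + 1) s').map fun τ => Function.update τ h s

/-- The entropic-risk value function
`V_h^π(s) = (1/β) log E[exp(β ∑_{i=h}^H r_i(s_i, π_i(s_i))) | s_h = s]`. -/
def MDP.value (M : MDP S A H) (β : ℝ) (π : Policy S A) (h : ℕ) (s : S) : ℝ :=
  1 / β * Real.log (expect (M.trajLaw π (H + 1 - h) h s) fun τ =>
    Real.exp (β * ∑ i ∈ Finset.Icc h H, M.r i (τ i) (π i (τ i))))

/-- The optimal value `V_h^*(s) = sup_π V_h^π(s)`; the supremum is over a bounded set, as every
`V_h^π(s)` with `1 ≤ h ≤ H + 1` lies in `[0, H]`. -/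
def MDP.optValue (M : MDP S A H) (β : ℝ) (h : ℕ) (s : S) : ℝ :=
  ⨆ π : Policy S A, M.value β π h s

end Values

/-- The parameters of the algorithm: risk parameter `β`, confidence level `δ`, bonus constant `c`
and number of episodes `K`. -/
structure Params where
  β : ℝ
  δ : ℝ
  c : ℝ
  K : ℕ

/-- The learning rate `α_t = (H + 1) / (H + t)`. -/
def learnRate (H t : ℕ) : ℝ := ((H : ℝ) + 1) / ((H : ℝ) + t)

/-- `log (S A T / δ)` with `T = K H`. -/
def logFactor (S A : Type*) [Fintype S] [Fintype A] (H K : ℕ) (δ : ℝ) : ℝ :=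
  Real.log ((Fintype.card S : ℝ) * Fintype.card A * ((K : ℝ) * H) / δ)

/-- The bonus `b_t = c |e^{βH} - 1| √(H log (S A T / δ) / t)`. -/
def bonus (S A : Type*) [Fintype S] [Fintype A] (H : ℕ) (p : Params) (t : ℕ) : ℝ :=
  p.c * |Real.exp (p.β * H) - 1| * √((H : ℝ) * logFactor S A H p.K p.δ / t)

/-- The memory of the algorithm: estimates `Q_h(s, a)` and `V_h(s)`, and visit counts
`N_h(s, a)`. -/
@[ext]
structure Memory (S A : Type*) where
  Q : ℕ → S → A → ℝ
  V : ℕ → S → ℝ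
  N : ℕ → S → A → ℕ

/-- Initially `Q_h, V_h = H - h + 1` for `h ≤ H`, `Q_{H+1}, V_{H+1} = 0` and `N_h = 0`. -/
def Memory.init (S A : Type*) (H : ℕ) : Memory S A where
  Q h _ _ := if h ≤ H then (H : ℝ) - h + 1 else 0
  V h _ := if h ≤ H then (H : ℝ) - h + 1 else 0
  N _ _ _ := 0

/-- The record of an episode: the initial state, the policy at the beginning of the episode, and
the observed transitions `(s_h, a_h, s_{h+1})`, `h = 1, …, H`. -/
structure Episode (S A : Type*) where
  initState : S
  policy : Policy S A
  transitions : List (S × A × S)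

section Algorithm

variable {S A : Type*} [Fintype S] [Fintype A] [DecidableEq S] [DecidableEq A] [Nonempty A]
variable {H : ℕ}

/-- The new value of `Q_h(s, a)` after the transition `(s, a, s')` at step `h`. -/
def newQ (M : MDP S A H) (p : Params) (m : Memory S A) (h : ℕ) (s : S) (a : A) (s' : S) : ℝ :=
  let t := m.N h s a + 1
  let α := learnRate H t
  let b := bonus S A H p t
  let w := (1 - α) * Real.exp (p.β * m.Q h s a)
    + α * Real.exp (p.β * (M.r h s a + m.V (h + 1) s'))
  if 0 < p.β then
    1 / p.β * Real.log (min (Real.exp (p.β * ((H : ℝ) - h + 1))) (w + α * b))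
  else
    1 / p.β * Real.log (max (Real.exp (p.β * ((H : ℝ) - h + 1))) (w - α * b))

/-- The update of the memory after the transition `(s, a, s')` at step `h`: the entries
`N_h(s, a)` and `Q_h(s, a)` are replaced, and then `V_h(s)` by `max_{a'} Q_h(s, a')`. -/
def update (M : MDP S A H) (p : Params) (m : Memory S A) (h : ℕ) (s : S) (a : A) (s' : S) :
    Memory S A :=
  let q : A → ℝ := Function.update (m.Q h s) a (newQ M p m h s a s')
  { Q := Function.update m.Q h (Function.update (m.Q h) s q)
    V := Function.update m.V h
      (Function.update (m.V h) s (Finset.univ.sup' Finset.univ_nonempty q))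
    N := Function.update m.N h
      (Function.update (m.N h) s (Function.update (m.N h s) a (m.N h s a + 1))) }

/-- The interaction during the last `n` steps of an episode, from state `s` at step `h` and with
memory `m`. In each step the action `argmax_{a'} Q_h(s, a')` is taken for the current `Q`
(`sel h s` picks a maximizer), the next state is drawn from the MDP, and the memory is updated.
The result is the law of the final memory together with the observed transitions. -/
def steps (M : MDP S A H) (p : Params) (sel : ℕ → S → (A → ℝ) → A) :
    ℕ → ℕ → S → Memory S A → PMF (Memory S A × List (S × A × S))
  | 0, _, _, m => PMF.pure (m, [])
  | n + 1, h, s, m =>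
      let a := sel h s (m.Q h s)
      (M.P h s a).bind fun s' =>
        (steps M p sel n (h + 1) s' (update M p m h s a s')).map fun x => (x.1, (s, a, s') :: x.2)

/-- The law of the memory and of the episode records after `k` episodes. The environment chooses
the initial state of an episode by an arbitrary, possibly randomized rule `env` that may depend on
all past episodes; ties in the argmax are broken by an arbitrary rule `sel`, which may depend on the
past episodes, the step and the state. The policy of an episode is greedy for the estimates `Q` at
its beginning. -/
def run (M : MDP S A H) (p : Params) (env : List (Episode S A) → PMF S)
    (sel : List (Episode S A) → ℕ → S → (A → ℝ) → A) :
    ℕ → PMF (Memory S A × List (Episode S A))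
  | 0 => PMF.pure (Memory.init S A H, [])
  | k + 1 => (run M p env sel k).bind fun x =>
      (env x.2).bind fun s₁ =>
        (steps M p (sel x.2) H 1 s₁ x.1).map fun y =>
          (y.1, x.2 ++ [⟨s₁, fun h s => sel x.2 h s (x.1.Q h s), y.2⟩])

end Algorithm

/-- The regret of a sequence of episodes: the sum of `V_1^*(s_1^k) - V_1^{π^k}(s_1^k)`. -/
def regret {S A : Type*} {H : ℕ} (M : MDP S A H) (β : ℝ) (l : List (Episode S A)) : ℝ :=
  (l.map fun e => M.optValue β 1 e.initState - M.value β e.policy 1 e.initState).sum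

/-- `λ(u) = (e^{3u} - 1) / u`. -/
def lam (u : ℝ) : ℝ := (Real.exp (3 * u) - 1) / u

end RSQ

end

/-! The increasing map `util`, x ↦ sign(β)e^{βx}, makes the entropic Bellman equations linear: a
backup multiplies the mean of the next value by e^{βr}. In this scale, for both signs of β, a
learning step is x ← min(cap, (1-α)x + α(e^{βr}V + b)), so the analysis of optimistic Q-learning
applies. The logarithm is undone only at the end, with Lipschitz constant max(1, e^{-βH})/|β|.

Optimism. The excess of an estimate over the optimal action value dominates `reflect`, a recursion
driven only by the centred noise of the optimal next value, started and capped at the `slack` η.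
Since the cap may restart it at any visit, its value is not a single weighted sum of noises. For
each visit t, `reflectPot` therefore adds to the exponential of the current value one term for every
restart that may still occur. Hoeffding's lemma, with weights α_j·`carry` ≤ 2H/t, makes this a
supermartingale (`stoppedPot_super`), and a first negative value at visit t makes it at least 1. It
starts below (t+1)(e^{-θη} + e^{-C}), where θη is of order √(ιt), C = c²ι/4 and ι is the log factor.
The sum over t ≤ K and over all triples (h, s, a) tends to 0 as ι → ∞, at a rate depending on the
positive slacks, hence on the MDP. A triple with η = 0 carries no noise and never fails.

Regret. `memoryPot` weights the error of a triple after n visits by (n+H)/H. A visit then releases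
the current error at the price of 1+1/H times the excess of the sampled target, while the bonuses
are summed by a multiple of √n (`cellPot_newQ`). Propagation along an episode costs at most
(1+1/H)max(1, e^β) per step, and telescoping gives `run_inv`: the transformed regret is at most the
initial minus the final potential plus a martingale. Optimism leaves only the bonus part of the
final potential, which Cauchy–Schwarz bounds by a multiple of √(SAK) per step. The initial potential
and the martingale are O(√K) without the factor √ι, so the main term absorbs them once ι is large.
-/

noncomputable section

namespace RSQ

open scoped ENNReal

/-! ### Expectations under discrete laws, Markov's and Hoeffding's inequalities -/

section Expectation

/-- Expectation of an extended nonnegative function under a discrete law. -/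
def pexp {X : Type*} (p : PMF X) (Φ : X → ℝ≥0∞) : ℝ≥0∞ := ∑' x, p x * Φ x

variable {X Y : Type*}

theorem pexp_mono (p : PMF X) {Φ Φ' : X → ℝ≥0∞} (h : ∀ x ∈ p.support, Φ x ≤ Φ' x) :
    pexp p Φ ≤ pexp p Φ' := by
  refine ENNReal.tsum_le_tsum fun x => ?_
  by_cases hx : p x = 0
  · simp [hx]
  · exact mul_le_mul_right (h x ((PMF.mem_support_iff p x).2 hx)) _

theorem pexp_const (p : PMF X) (a : ℝ≥0∞) : pexp p (fun _ => a) = a := by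
  simp [pexp, ENNReal.tsum_mul_right, p.tsum_coe]

theorem pexp_pure (a : X) (Φ : X → ℝ≥0∞) : pexp (PMF.pure a) Φ = Φ a := by
  unfold pexp
  rw [tsum_eq_single a]
  · simp
  · intro b hb
    simp [PMF.pure_apply, hb]

theorem pexp_bind (p : PMF X) (q : X → PMF Y) (Φ : Y → ℝ≥0∞) :
    pexp (p.bind q) Φ = pexp p fun x => pexp (q x) Φ := by
  simp only [pexp, PMF.bind_apply, ← ENNReal.tsum_mul_right, ← ENNReal.tsum_mul_left]
  rw [ENNReal.tsum_comm]
  simp only [mul_assoc]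

theorem pexp_map (p : PMF X) (f : X → Y) (Φ : Y → ℝ≥0∞) :
    pexp (p.map f) Φ = pexp p fun x => Φ (f x) := by
  rw [← PMF.bind_pure_comp, pexp_bind]
  simp [pexp_pure]

theorem pexp_add (p : PMF X) (Φ Φ' : X → ℝ≥0∞) :
    pexp p (fun x => Φ x + Φ' x) = pexp p Φ + pexp p Φ' := by
  simp [pexp, mul_add, ENNReal.tsum_add]

theorem pexp_sum {ι : Type*} (p : PMF X) (I : Finset ι) (Φ : ι → X → ℝ≥0∞) :
    pexp p (fun x => ∑ i ∈ I, Φ i x) = ∑ i ∈ I, pexp p (Φ i) := by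
  classical
  induction I using Finset.induction_on with
  | empty => simp [pexp]
  | insert a I ha ih => simp [Finset.sum_insert ha, pexp_add, ih]

theorem pexp_ofReal [Fintype X] (p : PMF X) (f : X → ℝ) (hf : ∀ x, 0 ≤ f x) :
    pexp p (fun x => ENNReal.ofReal (f x)) = ENNReal.ofReal (∑ x, (p x).toReal * f x) := by
  rw [ENNReal.ofReal_sum_of_nonneg fun x _ => mul_nonneg ENNReal.toReal_nonneg (hf x)]
  rw [pexp, tsum_fintype]
  refine Finset.sum_congr rfl fun x _ => ?_
  rw [ENNReal.ofReal_mul ENNReal.toReal_nonneg, ENNReal.ofReal_toReal (p.apply_ne_top x)]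

/-- Markov's inequality: Φ dominates the indicator of the complement of E on the support. -/
theorem one_sub_le_toOuterMeasure (p : PMF X) (E : Set X) (Φ : X → ℝ≥0∞) {ε : ℝ} (hε : 0 ≤ ε)
    (h : ∀ x ∈ p.support, x ∉ E → 1 ≤ Φ x) (hΦ : pexp p Φ ≤ ENNReal.ofReal ε) :
    ENNReal.ofReal (1 - ε) ≤ p.toOuterMeasure E := by
  have h1 : (1 : ℝ≥0∞) ≤ p.toOuterMeasure E + ENNReal.ofReal ε := by
    calc (1 : ℝ≥0∞) = pexp p (fun _ => 1) := (pexp_const p 1).symm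
      _ ≤ pexp p (fun x => E.indicator 1 x + Φ x) := by
        refine pexp_mono p fun x hx => ?_
        by_cases hE : x ∈ E
        · simp [hE]
        · simpa [hE] using h x hx hE
      _ = pexp p (E.indicator 1) + pexp p Φ := pexp_add _ _ _
      _ ≤ _ := by
        refine add_le_add (le_of_eq ?_) hΦ
        rw [PMF.toOuterMeasure_apply, pexp]
        refine tsum_congr fun x => ?_
        by_cases hE : x ∈ E <;> simp [hE]
  rw [ENNReal.ofReal_sub _ hε, ENNReal.ofReal_one]
  exact tsub_le_iff_right.2 h1

theorem sum_toReal [Fintype X] (p : PMF X) : ∑ x, (p x).toReal = 1 := by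
  have h := p.tsum_coe
  rw [tsum_fintype] at h
  rw [← ENNReal.toReal_sum fun x _ => p.apply_ne_top x, h, ENNReal.toReal_one]

theorem avg_le [Fintype X] (p : PMF X) {f : X → ℝ} {b : ℝ} (h : ∀ x, f x ≤ b) :
    ∑ x, (p x).toReal * f x ≤ b := by
  calc _ ≤ ∑ x, (p x).toReal * b :=
        Finset.sum_le_sum fun x _ => mul_le_mul_of_nonneg_left (h x) ENNReal.toReal_nonneg
    _ = b := by rw [← Finset.sum_mul, sum_toReal, one_mul]

theorem le_avg [Fintype X] (p : PMF X) {f : X → ℝ} {b : ℝ} (h : ∀ x, b ≤ f x) :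
    b ≤ ∑ x, (p x).toReal * f x := by
  calc b = ∑ x, (p x).toReal * b := by rw [← Finset.sum_mul, sum_toReal, one_mul]
    _ ≤ _ := Finset.sum_le_sum fun x _ => mul_le_mul_of_nonneg_left (h x) ENNReal.toReal_nonneg

theorem avg_mono [Fintype X] (p : PMF X) {f g : X → ℝ} (h : ∀ x, f x ≤ g x) :
    ∑ x, (p x).toReal * f x ≤ ∑ x, (p x).toReal * g x :=
  Finset.sum_le_sum fun x _ => mul_le_mul_of_nonneg_left (h x) ENNReal.toReal_nonneg

/-- Hoeffding's lemma for a centred bounded function under a discrete law. -/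
theorem hoeffding [Fintype X] (p : PMF X) (f : X → ℝ) {B : ℝ} (hB : 0 < B)
    (hf : ∀ x, |f x| ≤ B) (h0 : ∑ x, (p x).toReal * f x = 0) (θ : ℝ) :
    ∑ x, (p x).toReal * Real.exp (θ * f x) ≤ Real.exp (θ ^ 2 * B ^ 2 / 2) := by
  -- On [-B, B] the exponential lies below its chord; the linear part of the chord has mean zero,
  -- which leaves cosh(θB).
  have key : ∀ x, Real.exp (θ * f x) ≤
      Real.cosh (θ * B) + f x * (Real.sinh (θ * B) / B) := by
    intro x
    obtain ⟨h1, h2⟩ := abs_le.1 (hf x)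
    have hc := convexOn_exp.2 (Set.mem_univ (θ * B)) (Set.mem_univ (-(θ * B)))
      (show 0 ≤ (B + f x) / (2 * B) from div_nonneg (by linarith) (by linarith))
      (show 0 ≤ (B - f x) / (2 * B) from div_nonneg (by linarith) (by linarith))
      (by field_simp; ring)
    simp only [smul_eq_mul] at hc
    have e1 : (B + f x) / (2 * B) * (θ * B) + (B - f x) / (2 * B) * -(θ * B) = θ * f x := by
      field_simp; ring
    rw [e1] at hc
    refine hc.trans (le_of_eq ?_)
    rw [Real.cosh_eq, Real.sinh_eq]
    field_simp
    ring
  calc ∑ x, (p x).toReal * Real.exp (θ * f x)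
      ≤ ∑ x, (p x).toReal * (Real.cosh (θ * B) + f x * (Real.sinh (θ * B) / B)) :=
        avg_mono p key
    _ = Real.cosh (θ * B) := by
        simp only [mul_add, ← mul_assoc, Finset.sum_add_distrib, ← Finset.sum_mul, h0, sum_toReal]
        ring
    _ ≤ Real.exp ((θ * B) ^ 2 / 2) := Real.cosh_le_exp_half_sq _
    _ = _ := by rw [mul_pow]

end Expectation

/-! ### Supermartingales along the history of transitions -/

section History

variable {S A : Type*}

/-- An observed transition `(s, a, s')` at step `h` of an episode with policy `π`, as the tuple
`(π, h, s, a, s')`. -/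
abbrev Transition (S A : Type*) := Policy S A × ℕ × S × A × S

/-- Push the transitions of (the rest of) an episode, the first one at step `h`, onto a history.
Histories are listed with the latest transition first. -/
def push (π : Policy S A) : ℕ → List (S × A × S) → List (Transition S A) → List (Transition S A)
  | _, [], l => l
  | h, x :: xs, l => push π (h + 1) xs ((π, h, x) :: l)

/-- The history of transitions of a list of episodes. -/
def history (L : List (Episode S A)) : List (Transition S A) :=
  L.foldl (fun l e => push e.policy 1 e.transitions l) []

theorem history_concat (L : List (Episode S A)) (e : Episode S A) :
    history (L ++ [e]) = push e.policy 1 e.transitions (history L) := by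
  simp [history, List.foldl_append]

variable {H : ℕ}

/-- A functional of the history which decreases on average at each transition. -/
def IsSupermartingale (M : MDP S A H) (Ψ : List (Transition S A) → ℝ≥0∞) : Prop :=
  ∀ l π h s a, h ∈ Finset.Icc 1 H →
    pexp (M.P h s a) (fun s' => Ψ ((π, h, s, a, s') :: l)) ≤ Ψ l

variable [Fintype S] [Fintype A] [DecidableEq S] [DecidableEq A] [Nonempty A]

theorem IsSupermartingale.steps {M : MDP S A H} {Ψ : List (Transition S A) → ℝ≥0∞}
    (hΨ : IsSupermartingale M Ψ) (p : Params) (sel : ℕ → S → (A → ℝ) → A) (π : Policy S A)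
    (n : ℕ) : ∀ (h : ℕ) (s : S) (m : Memory S A) (l : List (Transition S A)),
      1 ≤ h → h + n = H + 1 →
      pexp (RSQ.steps M p sel n h s m) (fun y => Ψ (push π h y.2 l)) ≤ Ψ l := by
  induction n with
  | zero =>
    intro h s m l _ _
    simp [RSQ.steps, pexp_pure, push]
  | succ n ih =>
    intro h s m l h1 h2
    rw [RSQ.steps, pexp_bind]
    simp only [pexp_map, push]
    refine (pexp_mono _ fun s' _ => ih (h + 1) s' _ _ (by omega) (by omega)).trans ?_
    exact hΨ _ _ _ _ _ (Finset.mem_Icc.2 ⟨h1, by omega⟩)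

/-- The supermartingale inequality is required for every state, action and policy label, so neither
the environment, nor the tie-breaking, nor the memory can spoil it; only the draws from the kernels
matter. -/
theorem IsSupermartingale.run {M : MDP S A H} {Ψ : List (Transition S A) → ℝ≥0∞}
    (hΨ : IsSupermartingale M Ψ) (p : Params) (env : List (Episode S A) → PMF S)
    (sel : List (Episode S A) → ℕ → S → (A → ℝ) → A) (k : ℕ) :
    pexp (RSQ.run M p env sel k) (fun x => Ψ (history x.2)) ≤ Ψ [] := by
  induction k with
  | zero => simp [RSQ.run, pexp_pure, history]
  | succ k ih =>
    rw [RSQ.run, pexp_bind]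
    refine le_trans (pexp_mono _ fun x _ => ?_) ih
    rw [pexp_bind]
    refine (pexp_mono _ fun s _ => ?_).trans (pexp_const (env x.2) _).le
    rw [pexp_map]
    simp only [history_concat]
    exact hΨ.steps p (sel x.2) _ H 1 s x.1 _ le_rfl (by omega)

end History


/-! ### Learning rates and their products -/

section LearnRate

variable {H : ℕ}

theorem learnRate_pos (H t : ℕ) (ht : 1 ≤ t) : 0 < learnRate H t := by
  have : (1 : ℝ) ≤ t := by exact_mod_cast ht
  unfold learnRate
  positivity

theorem one_sub_learnRate (H t : ℕ) (ht : 1 ≤ t) :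
    1 - learnRate H t = ((t : ℝ) - 1) / ((H : ℝ) + t) := by
  have : (1 : ℝ) ≤ t := by exact_mod_cast ht
  have : (H : ℝ) + t ≠ 0 := by positivity
  unfold learnRate
  field_simp
  ring

theorem one_sub_learnRate_nonneg (H t : ℕ) (ht : 1 ≤ t) : 0 ≤ 1 - learnRate H t := by
  have : (1 : ℝ) ≤ t := by exact_mod_cast ht
  rw [one_sub_learnRate H t ht]
  exact div_nonneg (by linarith) (by positivity)

/-- The weight with which the estimate after `j` visits enters the one after `t` visits. -/
def carry (H t j : ℕ) : ℝ := ∏ i ∈ Finset.Ioc j t, (1 - learnRate H i)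

theorem carry_self (H t : ℕ) : carry H t t = 1 := by simp [carry]

theorem carry_succ {t j : ℕ} (h : j < t) :
    carry H t j = (1 - learnRate H (j + 1)) * carry H t (j + 1) := by
  unfold carry
  have : Finset.Ioc j t = insert (j + 1) (Finset.Ioc (j + 1) t) := by
    ext i; simp only [Finset.mem_Ioc, Finset.mem_insert]; omega
  rw [this, Finset.prod_insert (by simp)]

theorem carry_nonneg (H t j : ℕ) : 0 ≤ carry H t j :=
  Finset.prod_nonneg fun i hi => one_sub_learnRate_nonneg H i (by
    have := (Finset.mem_Ioc.1 hi).1; omega)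

theorem carry_le_one (H t j : ℕ) : carry H t j ≤ 1 := by
  refine Finset.prod_le_one (fun i hi => one_sub_learnRate_nonneg H i ?_) fun i hi => ?_
  · have := (Finset.mem_Ioc.1 hi).1; omega
  · have h1 := learnRate_pos H i (by have := (Finset.mem_Ioc.1 hi).1; omega)
    linarith

/-- The weight of the j-th observation in the t-th estimate grows with j, because α_k(1-α_{k+1}) ≤
α_{k+1}; so it is at most α_t = (H+1)/(H+t). -/
theorem learnRate_mul_carry_le (hH : 1 ≤ H) {t j : ℕ} (hj : 1 ≤ j) (hjt : j ≤ t) :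
    learnRate H j * carry H t j ≤ 2 * H / t := by
  have hH' : (1 : ℝ) ≤ H := by exact_mod_cast hH
  have ht' : (1 : ℝ) ≤ t := by exact_mod_cast hj.trans hjt
  have key : learnRate H j * carry H t j ≤ learnRate H t := by
    induction hjt using Nat.decreasingInduction with
    | self => simp [carry_self]
    | of_succ k hk ih =>
      refine le_trans ?_ (ih (by omega))
      rw [carry_succ hk, ← mul_assoc]
      refine mul_le_mul_of_nonneg_right ?_ (carry_nonneg _ _ _)
      rw [one_sub_learnRate H (k + 1) (by omega), learnRate, learnRate]
      have hk' : (1 : ℝ) ≤ k := by exact_mod_cast hj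
      push_cast
      rw [div_mul_div_comm, div_le_div_iff₀ (by positivity) (by positivity)]
      have : ((k : ℝ) + 1 - 1) ≤ H + k := by linarith
      have h3 : (0 : ℝ) ≤ (H + 1) * (H + (k + 1)) := by positivity
      nlinarith
  refine key.trans ?_
  rw [learnRate, div_le_div_iff₀ (by positivity) (by positivity)]
  nlinarith

end LearnRate

/-! ### The capped recursion and its exponential potential -/

section Reflect

variable {S : Type*}

/-- The reflected learning recursion driven by the observations `l` (latest first): a process
capped at `η`, with increments `X` and bonuses `b`. -/
def reflect (H : ℕ) (b : ℕ → ℝ) (η : ℝ) (X : S → ℝ) : List S → ℝ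
  | [] => η
  | s :: l => min η ((1 - learnRate H (l.length + 1)) * reflect H b η X l
      + learnRate H (l.length + 1) * (X s + b (l.length + 1)))

/-- The reflected recursion has been nonnegative up to now. -/
def StaysNonneg (H : ℕ) (b : ℕ → ℝ) (η : ℝ) (X : S → ℝ) : List S → Prop
  | [] => True
  | s :: l => 0 ≤ reflect H b η X (s :: l) ∧ StaysNonneg H b η X l

theorem StaysNonneg.reflect_nonneg {H : ℕ} {b : ℕ → ℝ} {η : ℝ} {X : S → ℝ} (hη : 0 ≤ η)
    {l : List S} (h : StaysNonneg H b η X l) : 0 ≤ reflect H b η X l := by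
  cases l with
  | nil => exact hη
  | cons s l => exact h.1

theorem staysNonneg_of_zero {H : ℕ} {b : ℕ → ℝ} {η : ℝ} {X : S → ℝ} (hη : 0 ≤ η)
    (hb : ∀ t, 0 ≤ b t) (hX : ∀ s, X s = 0) (l : List S) : StaysNonneg H b η X l := by
  induction l with
  | nil => trivial
  | cons s l ih =>
    refine ⟨le_min hη ?_, ih⟩
    rw [hX, zero_add]
    exact add_nonneg (mul_nonneg (one_sub_learnRate_nonneg H _ (by omega))
      (ih.reflect_nonneg hη)) (mul_nonneg (learnRate_pos H _ (by omega)).le (hb _))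

/-- The potential controlling `reflect` at the `t`-th observation, before that observation. -/
def reflectPot (H : ℕ) (b : ℕ → ℝ) (η : ℝ) (X : S → ℝ) (t : ℕ) (θ C : ℝ) (l : List S) : ℝ :=
  Real.exp (-(θ * (carry H t l.length * reflect H b η X l)) - (1 - carry H t l.length) * C)
    + ∑ τ ∈ Finset.Ioc l.length t, Real.exp (-(θ * (carry H t τ * η)) - (1 - carry H t τ) * C)

/-- The potential `reflectPot`, frozen at the `t`-th observation. -/
def stoppedPot (H : ℕ) (b : ℕ → ℝ) (η : ℝ) (X : S → ℝ) (t : ℕ) (θ C : ℝ) : List S → ℝ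
  | [] => reflectPot H b η X t θ C []
  | s :: l => if l.length < t then reflectPot H b η X t θ C (s :: l)
      else stoppedPot H b η X t θ C l

variable {H : ℕ} {b : ℕ → ℝ} {η : ℝ} {X : S → ℝ} {t : ℕ} {θ C : ℝ}

theorem reflectPot_nonneg (l : List S) : 0 ≤ reflectPot H b η X t θ C l := by
  unfold reflectPot
  positivity

theorem stoppedPot_nonneg (l : List S) : 0 ≤ stoppedPot H b η X t θ C l := by
  induction l with
  | nil => exact reflectPot_nonneg _
  | cons s l ih =>
    rw [stoppedPot]
    split_ifs
    · exact reflectPot_nonneg _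
    · exact ih

theorem stoppedPot_of_le {l : List S} (h : l.length ≤ t) :
    stoppedPot H b η X t θ C l = reflectPot H b η X t θ C l := by
  cases l with
  | nil => rfl
  | cons s l => rw [stoppedPot, if_pos (by simpa [Nat.succ_le_iff] using h)]

/-- Take for t the first time the recursion is negative: the carry is 1, no restart is left to come,
and the remaining exponent is nonnegative. Later observations leave the frozen potential unchanged.
-/
theorem exists_one_le_stoppedPot (θ : ℕ → ℝ) (hθ : ∀ t, 0 ≤ θ t) {l : List S}
    (h : ¬ StaysNonneg H b η X l) :
    ∃ t ∈ Finset.Icc 1 l.length, 1 ≤ stoppedPot H b η X t (θ t) C l := by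
  induction l with
  | nil => exact absurd trivial h
  | cons s l ih =>
    by_cases hl : StaysNonneg H b η X l
    · have h0 : reflect H b η X (s :: l) < 0 := by
        by_contra! h0
        exact h ⟨h0, hl⟩
      refine ⟨l.length + 1, by simp, ?_⟩
      rw [stoppedPot_of_le (by simp), reflectPot]
      simp only [List.length_cons, carry_self, Finset.Ioc_self, Finset.sum_empty, add_zero,
        Real.one_le_exp_iff]
      have := mul_nonneg (hθ (l.length + 1)) (neg_nonneg.2 h0.le)
      linarith
    · obtain ⟨t, ht, h1⟩ := ih hl
      rw [Finset.mem_Icc] at ht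
      refine ⟨t, Finset.mem_Icc.2 ⟨ht.1, by simp; omega⟩, ?_⟩
      rwa [stoppedPot, if_neg (by omega)]

/-- Each of the t+1 exponents is a convex combination of -θη and -C. -/
theorem stoppedPot_nil_le :
    stoppedPot H b η X t θ C [] ≤ (t + 1) * (Real.exp (-(θ * η)) + Real.exp (-C)) := by
  have key : ∀ τ, Real.exp (-(θ * (carry H t τ * η)) - (1 - carry H t τ) * C) ≤
      Real.exp (-(θ * η)) + Real.exp (-C) := by
    intro τ
    have hc := convexOn_exp.2 (Set.mem_univ (-(θ * η))) (Set.mem_univ (-C))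
      (carry_nonneg H t τ) (sub_nonneg.2 (carry_le_one H t τ)) (by ring)
    simp only [smul_eq_mul] at hc
    have e : carry H t τ * -(θ * η) + (1 - carry H t τ) * -C =
      -(θ * (carry H t τ * η)) - (1 - carry H t τ) * C := by ring
    rw [e] at hc
    refine hc.trans ?_
    have h1 := mul_le_mul_of_nonneg_right (carry_le_one H t τ) (Real.exp_pos (-(θ * η))).le
    have h2 : (1 - carry H t τ) * Real.exp (-C) ≤ 1 * Real.exp (-C) :=
      mul_le_mul_of_nonneg_right (by linarith [carry_nonneg H t τ]) (Real.exp_pos _).le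
    linarith
  rw [stoppedPot, reflectPot]
  simp only [List.length_nil, reflect]
  have h1 : ∑ τ ∈ Finset.Ioc 0 t, Real.exp (-(θ * (carry H t τ * η)) - (1 - carry H t τ) * C) ≤
      ∑ τ ∈ Finset.Ioc 0 t, (Real.exp (-(θ * η)) + Real.exp (-C)) :=
    Finset.sum_le_sum fun τ _ => key τ
  rw [Finset.sum_const, Nat.card_Ioc, nsmul_eq_mul] at h1
  have h2 := key 0
  simp only [Nat.sub_zero] at h1
  linarith

variable [Fintype S]

/-- If the cap is hit, the new value is paid for by the restart term already present in the sum;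
otherwise the step is affine and Hoeffding's lemma applies. The condition on C says that the bonus
outweighs the variance. -/
theorem stoppedPot_super (hH : 1 ≤ H) (P : PMF S) {B : ℝ} (hB : 0 < B)
    (hX : ∀ s, |X s| ≤ B) (hX0 : ∑ s, (P s).toReal * X s = 0)
    (hb : ∀ j, 1 ≤ j → j ≤ t → b t ≤ b j) (hθ : 0 ≤ θ)
    (hC : C ≤ θ * b t - θ ^ 2 * B ^ 2 * H / t) (l : List S) :
    ∑ s, (P s).toReal * stoppedPot H b η X t θ C (s :: l) ≤ stoppedPot H b η X t θ C l := by
  by_cases hl : t ≤ l.length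
  · simp only [stoppedPot, not_lt.2 hl, if_false]
    rw [← Finset.sum_mul, sum_toReal, one_mul]
  push Not at hl
  set j := l.length with hj
  set ζ := reflect H b η X l with hζ
  set α := learnRate H (j + 1) with hα
  set q := carry H t (j + 1) with hq
  set R := ∑ τ ∈ Finset.Ioc (j + 1) t,
    Real.exp (-(θ * (carry H t τ * η)) - (1 - carry H t τ) * C) with hR
  have hαpos : 0 < α := learnRate_pos H _ (by omega)
  have hq0 : 0 ≤ q := carry_nonneg _ _ _
  have hcs : carry H t j = (1 - α) * q := carry_succ hl
  have hsplit : ∑ τ ∈ Finset.Ioc j t,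
      Real.exp (-(θ * (carry H t τ * η)) - (1 - carry H t τ) * C) =
      Real.exp (-(θ * (q * η)) - (1 - q) * C) + R := by
    have : Finset.Ioc j t = insert (j + 1) (Finset.Ioc (j + 1) t) := by
      ext i; simp only [Finset.mem_Ioc, Finset.mem_insert]; omega
    rw [this, Finset.sum_insert (by simp)]
  rw [stoppedPot_of_le hl.le, reflectPot, hsplit, ← hj, ← hζ, hcs]
  -- The two branches of the minimum are bounded by the sum of their contributions, so the mean can
  -- be taken without conditioning on which one occurs.
  have hpt : ∀ s, stoppedPot H b η X t θ C (s :: l) ≤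
      Real.exp (-(θ * (q * η)) - (1 - q) * C) + R +
      Real.exp (-(θ * ((1 - α) * q * ζ)) - θ * (α * q) * b (j + 1) - (1 - q) * C) *
        Real.exp (-(θ * (α * q)) * X s) := by
    intro s
    rw [stoppedPot_of_le (by simpa using hl), reflectPot, reflect, List.length_cons, ← hj, ← hζ,
      ← hα, ← hq, ← hR]
    rw [← Real.exp_add]
    rcases le_total η ((1 - α) * ζ + α * (X s + b (j + 1))) with h | h
    · rw [min_eq_left h]
      have := Real.exp_pos (-(θ * ((1 - α) * q * ζ)) - θ * (α * q) * b (j + 1) - (1 - q) * C +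
        -(θ * (α * q)) * X s)
      linarith
    · rw [min_eq_right h]
      have e : -(θ * (q * ((1 - α) * ζ + α * (X s + b (j + 1))))) - (1 - q) * C =
        -(θ * ((1 - α) * q * ζ)) - θ * (α * q) * b (j + 1) - (1 - q) * C +
          -(θ * (α * q)) * X s := by ring
      rw [e]
      have := Real.exp_pos (-(θ * (q * η)) - (1 - q) * C)
      linarith
  refine (avg_mono P hpt).trans ?_
  simp only [mul_add, Finset.sum_add_distrib, ← Finset.sum_mul, sum_toReal, one_mul,
    mul_left_comm _ (Real.exp _) (Real.exp _), ← Finset.mul_sum]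
  have hh := hoeffding P X hB hX hX0 (-(θ * (α * q)))
  have hαq : α * q ≤ 2 * H / t := learnRate_mul_carry_le hH (by omega) hl
  have hαq0 : 0 ≤ α * q := mul_nonneg hαpos.le hq0
  have hbj : b t ≤ b (j + 1) := hb _ (by omega) hl
  -- The observation has weight αq, and 1-(1-α)q = (1-q)+αq, so it must gain αq·C. The bonus gives
  -- θαq·b_t, and αq ≤ 2H/t makes the quadratic Hoeffding term linear in αq.
  have hfin : Real.exp (-(θ * ((1 - α) * q * ζ)) - θ * (α * q) * b (j + 1) - (1 - q) * C) *
      ∑ s, (P s).toReal * Real.exp (-(θ * (α * q)) * X s) ≤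
      Real.exp (-(θ * ((1 - α) * q * ζ)) - (1 - (1 - α) * q) * C) := by
    refine (mul_le_mul_of_nonneg_left hh (Real.exp_pos _).le).trans ?_
    rw [← Real.exp_add, Real.exp_le_exp]
    have h1 : (α * q) * C ≤ (α * q) * (θ * b t - θ ^ 2 * B ^ 2 * H / t) :=
      mul_le_mul_of_nonneg_left hC hαq0
    have h2 : θ * (α * q) * b t ≤ θ * (α * q) * b (j + 1) :=
      mul_le_mul_of_nonneg_left hbj (mul_nonneg hθ hαq0)
    have h3 : (α * q) * (θ ^ 2 * B ^ 2 / 2) * (α * q) ≤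
        (α * q) * (θ ^ 2 * B ^ 2 / 2) * (2 * H / t) :=
      mul_le_mul_of_nonneg_left hαq (by positivity)
    have h4 : (α * q) * (θ ^ 2 * B ^ 2 / 2) * (2 * H / t) = (α * q) * (θ ^ 2 * B ^ 2 * H / t) := by
      ring
    nlinarith
  linarith

end Reflect


/-! ### The exponential utility transform -/

section Utility

/-- The sign of the risk parameter. -/
def sgn (β : ℝ) : ℝ := if 0 < β then 1 else -1

/-- The increasing transform `x ↦ sign(β) e^{βx}`, in which the learning recursion is affine. -/
def util (β x : ℝ) : ℝ := sgn β * Real.exp (β * x)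

theorem sgn_mul_self (β : ℝ) : sgn β * sgn β = 1 := by
  unfold sgn; split_ifs <;> norm_num

theorem abs_sgn (β : ℝ) : |sgn β| = 1 := by
  unfold sgn; split_ifs <;> norm_num

theorem util_zero (β : ℝ) : util β 0 = sgn β := by simp [util]

theorem util_mono (β : ℝ) : Monotone (util β) := by
  intro x y h
  unfold util sgn
  split_ifs with hβ
  · rw [one_mul, one_mul, Real.exp_le_exp]
    exact mul_le_mul_of_nonneg_left h hβ.le
  · have : Real.exp (β * y) ≤ Real.exp (β * x) :=
      Real.exp_le_exp.2 (mul_le_mul_of_nonpos_left h (not_lt.1 hβ))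
    linarith

theorem exp_mul_util (β r x : ℝ) : Real.exp (β * r) * util β x = util β (r + x) := by
  unfold util
  rw [mul_add, Real.exp_add]
  ring

theorem util_sub_util_zero {β : ℝ} {x : ℝ} (hx : 0 ≤ x) :
    util β x - util β 0 = |Real.exp (β * x) - 1| := by
  unfold util sgn
  split_ifs with hβ
  · have : 0 ≤ β * x := mul_nonneg hβ.le hx
    rw [abs_of_nonneg (by linarith [Real.add_one_le_exp (β * x)])]
    simp
  · have : Real.exp (β * x) ≤ 1 := Real.exp_le_one_iff.2
      (mul_nonpos_of_nonpos_of_nonneg (not_lt.1 hβ) hx)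
    rw [abs_of_nonpos (by linarith)]
    simp only [mul_zero, Real.exp_zero]
    ring

theorem abs_util_le {β x : ℝ} {H : ℕ} (h0 : 0 ≤ x) (hx : x ≤ H) :
    |util β x| ≤ Real.exp (|β| * H) := by
  rw [util, abs_mul, abs_sgn, one_mul, Real.abs_exp, Real.exp_le_exp]
  calc β * x ≤ |β| * x := mul_le_mul_of_nonneg_right (le_abs_self β) h0
    _ ≤ _ := mul_le_mul_of_nonneg_left hx (abs_nonneg β)

end Utility

/-! ### Linear Bellman equations for policy values and optimal values -/

section OptimalValues

variable {S A : Type*} {H : ℕ}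

/-- The factor `e^{βr_h(s,a)}`. -/
def gain (M : MDP S A H) (β : ℝ) (h : ℕ) (s : S) (a : A) : ℝ := Real.exp (β * M.r h s a)

theorem gain_pos (M : MDP S A H) (β : ℝ) (h : ℕ) (s : S) (a : A) : 0 < gain M β h s a :=
  Real.exp_pos _

/-- A bound on the factors `e^{βr}`. -/
def maxGain (β : ℝ) : ℝ := max 1 (Real.exp β)

theorem one_le_maxGain (β : ℝ) : 1 ≤ maxGain β := le_max_left _ _

theorem gain_le_maxGain (M : MDP S A H) (β : ℝ) {h : ℕ} (hh : h ∈ Finset.Icc 1 H) (s : S) (a : A) :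
    gain M β h s a ≤ maxGain β := by
  obtain ⟨h0, h1⟩ := M.r_mem h hh s a
  unfold gain maxGain
  rcases le_total 0 β with hβ | hβ
  · exact le_max_of_le_right (Real.exp_le_exp.2 (by nlinarith))
  · exact le_max_of_le_left (Real.exp_le_one_iff.2 (mul_nonpos_of_nonpos_of_nonneg hβ h0))

theorem gain_mul_mem (M : MDP S A H) (β : ℝ) {h : ℕ} (hh : h ∈ Finset.Icc 1 H) (s : S) (a : A)
    {x n : ℝ} (hx : x ∈ Set.Icc (util β 0) (util β n)) :
    gain M β h s a * x ∈ Set.Icc (util β 0) (util β (n + 1)) := by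
  obtain ⟨h0, h1⟩ := M.r_mem h hh s a
  constructor
  · calc util β 0 ≤ util β (M.r h s a + 0) := util_mono β (by linarith)
      _ = gain M β h s a * util β 0 := (exp_mul_util _ _ _).symm
      _ ≤ _ := mul_le_mul_of_nonneg_left hx.1 (gain_pos _ _ _ _ _).le
  · calc gain M β h s a * x ≤ gain M β h s a * util β n :=
          mul_le_mul_of_nonneg_left hx.2 (gain_pos _ _ _ _ _).le
      _ = util β (M.r h s a + n) := exp_mul_util _ _ _
      _ ≤ _ := util_mono β (by linarith)

variable [Fintype S]

/-- Bellman backup of the transformed values. -/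
def backup (M : MDP S A H) (β : ℝ) (h : ℕ) (s : S) (a : A) (F : S → ℝ) : ℝ :=
  gain M β h s a * ∑ s', (M.P h s a s').toReal * F s'

theorem backup_mono (M : MDP S A H) (β : ℝ) (h : ℕ) (s : S) (a : A) {F F' : S → ℝ}
    (hF : ∀ s, F s ≤ F' s) : backup M β h s a F ≤ backup M β h s a F' :=
  mul_le_mul_of_nonneg_left (avg_mono _ hF) (gain_pos _ _ _ _ _).le

theorem backup_mem (M : MDP S A H) (β : ℝ) {h : ℕ} (hh : h ∈ Finset.Icc 1 H) (s : S) (a : A)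
    {F : S → ℝ} {n : ℝ} (hF : ∀ s, F s ∈ Set.Icc (util β 0) (util β n)) :
    backup M β h s a F ∈ Set.Icc (util β 0) (util β (n + 1)) :=
  gain_mul_mem M β hh s a ⟨le_avg _ fun s => (hF s).1, avg_le _ fun s => (hF s).2⟩

/-- The transformed value of the policy `π` at step `h`, with `n` steps to go. -/
def policyValAux (M : MDP S A H) (β : ℝ) (π : Policy S A) : ℕ → ℕ → S → ℝ
  | 0, _, _ => sgn β
  | n + 1, h, s => backup M β h s (π h s) (policyValAux M β π n (h + 1))

/-- The transformed value `sign(β) e^{βV_h^π(s)}` of a policy. -/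
def policyVal (M : MDP S A H) (β : ℝ) (π : Policy S A) (h : ℕ) (s : S) : ℝ :=
  policyValAux M β π (H + 1 - h) h s

theorem policyVal_eq (M : MDP S A H) (β : ℝ) (π : Policy S A) {h : ℕ} (hh : h ≤ H) (s : S) :
    policyVal M β π h s = backup M β h s (π h s) (policyVal M β π (h + 1)) := by
  have e : H + 1 - h = (H + 1 - (h + 1)) + 1 := by omega
  unfold policyVal
  rw [e, policyValAux]

theorem policyVal_last (M : MDP S A H) (β : ℝ) (π : Policy S A) (s : S) :
    policyVal M β π (H + 1) s = sgn β := by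
  simp [policyVal, policyValAux]

/-- Backward induction over the steps `H + 1, …, 1`. -/
theorem backward_induction {H : ℕ} {Q : ℕ → Prop} (h0 : Q (H + 1))
    (h1 : ∀ h ∈ Finset.Icc 1 H, Q (h + 1) → Q h) : ∀ h ∈ Finset.Icc 1 (H + 1), Q h := by
  intro h hh
  rw [Finset.mem_Icc] at hh
  have := hh.2
  revert hh
  induction this using Nat.decreasingInduction with
  | self => exact fun _ => h0
  | of_succ k hk ih =>
    exact fun hh => h1 k (Finset.mem_Icc.2 ⟨hh.1, by omega⟩) (ih ⟨by omega, hk⟩)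

theorem policyVal_mem (M : MDP S A H) (β : ℝ) (π : Policy S A) :
    ∀ h ∈ Finset.Icc 1 (H + 1), ∀ s,
      policyVal M β π h s ∈ Set.Icc (util β 0) (util β ((H : ℝ) - h + 1)) := by
  refine backward_induction ?_ ?_
  · intro s
    rw [policyVal_last, util_zero]
    refine ⟨le_rfl, ?_⟩
    rw [← util_zero]
    exact util_mono β (by push_cast; linarith)
  · intro h hh ih s
    rw [policyVal_eq M β π (Finset.mem_Icc.1 hh).2]
    have := backup_mem M β hh s (π h s) ih
    convert this using 3
    push_cast
    ring

section Trajectory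

theorem expect_eq_pexp {X : Type*} (p : PMF X) {f : X → ℝ} (hf : ∀ x, 0 ≤ f x) :
    expect p f = (pexp p fun x => ENNReal.ofReal (f x)).toReal := by
  unfold expect pexp
  rw [ENNReal.tsum_toReal_eq fun x => ENNReal.mul_ne_top (p.apply_ne_top x) ENNReal.ofReal_ne_top]
  simp [ENNReal.toReal_ofReal, hf]

theorem sgn_mul_nonneg {β x : ℝ} {n : ℝ} (hx : x ∈ Set.Icc (util β 0) (util β n)) :
    0 < sgn β * x := by
  obtain ⟨h0, h1⟩ := hx
  rw [util_zero] at h0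
  unfold util at h1
  unfold sgn at *
  split_ifs at * with h
  · linarith
  · have := Real.exp_pos (β * n)
    linarith

/-- The exponential of the reward sum factors: the first reward is determined by the current state,
and the rest depends only on the trajectory after it. This reproduces the recursion of the backup.
-/
theorem pexp_trajLaw (M : MDP S A H) (β : ℝ) (π : Policy S A) :
    ∀ h ∈ Finset.Icc 1 (H + 1), ∀ s,
      (pexp (M.trajLaw π (H + 1 - h) h s) fun τ => ENNReal.ofReal
        (Real.exp (β * ∑ i ∈ Finset.Icc h H, M.r i (τ i) (π i (τ i))))) =
      ENNReal.ofReal (sgn β * policyVal M β π h s) := by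
  refine backward_induction ?_ ?_
  · intro s
    simp [MDP.trajLaw, pexp_pure, policyVal_last, sgn_mul_self]
  · intro h hh ih s
    have hH := (Finset.mem_Icc.1 hh)
    have e : H + 1 - h = (H + 1 - (h + 1)) + 1 := by omega
    rw [policyVal_eq M β π hH.2, e, MDP.trajLaw, pexp_bind]
    have key : ∀ τ : ℕ → S,
        ENNReal.ofReal (Real.exp (β * ∑ i ∈ Finset.Icc h H,
          M.r i (Function.update τ h s i) (π i (Function.update τ h s i)))) =
        ENNReal.ofReal (gain M β h s (π h s)) * ENNReal.ofReal (Real.exp (β *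
          ∑ i ∈ Finset.Icc (h + 1) H, M.r i (τ i) (π i (τ i)))) := by
      intro τ
      have hI : Finset.Icc h H = insert h (Finset.Icc (h + 1) H) := by
        ext i; simp only [Finset.mem_Icc, Finset.mem_insert]; omega
      rw [← ENNReal.ofReal_mul (gain_pos _ _ _ _ _).le, gain, ← Real.exp_add, hI,
        Finset.sum_insert (by simp), ← mul_add]
      congr 3
      simp only [Function.update_self]
      congr 1
      refine Finset.sum_congr rfl fun i hi => ?_
      have : i ≠ h := by have := (Finset.mem_Icc.1 hi).1; omega
      rw [Function.update_of_ne this]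
    have hm : ∀ (p : PMF (ℕ → S)) (a : ℝ≥0∞) (Φ : (ℕ → S) → ℝ≥0∞),
        pexp p (fun τ => a * Φ τ) = a * pexp p Φ := by
      intro p a Φ
      simp only [pexp, mul_left_comm _ a, ENNReal.tsum_mul_left]
    simp only [pexp_map, key, hm, ih]
    have hpos : ∀ s', 0 ≤ sgn β * policyVal M β π (h + 1) s' := fun s' =>
      (sgn_mul_nonneg (policyVal_mem M β π (h + 1) (Finset.mem_Icc.2 ⟨by omega, by omega⟩) s')).le
    simp only [← ENNReal.ofReal_mul (gain_pos M β h s (π h s)).le]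
    rw [pexp_ofReal _ _ fun s' => mul_nonneg (gain_pos _ _ _ _ _).le (hpos s'), backup]
    congr 1
    simp only [Finset.mul_sum]
    exact Finset.sum_congr rfl fun _ _ => by ring

theorem value_eq (M : MDP S A H) (β : ℝ) (π : Policy S A) {h : ℕ}
    (hh : h ∈ Finset.Icc 1 (H + 1)) (s : S) :
    M.value β π h s = 1 / β * Real.log (sgn β * policyVal M β π h s) := by
  rw [MDP.value, expect_eq_pexp _ fun _ => (Real.exp_pos _).le, pexp_trajLaw M β π h hh,
    ENNReal.toReal_ofReal (sgn_mul_nonneg (policyVal_mem M β π h hh s)).le]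

end Trajectory

variable [Fintype A] [Nonempty A]

/-- The transformed optimal value at step `h`, with `n` steps to go. -/
def optValAux (M : MDP S A H) (β : ℝ) : ℕ → ℕ → S → ℝ
  | 0, _, _ => sgn β
  | n + 1, h, s => Finset.univ.sup' Finset.univ_nonempty fun a =>
      backup M β h s a (optValAux M β n (h + 1))

/-- The transformed optimal value `sign(β) e^{βV_h^*(s)}`. -/
def optVal (M : MDP S A H) (β : ℝ) (h : ℕ) (s : S) : ℝ := optValAux M β (H + 1 - h) h s

/-- The transformed optimal action value `sign(β) e^{βQ_h^*(s,a)}`. -/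
def optQ (M : MDP S A H) (β : ℝ) (h : ℕ) (s : S) (a : A) : ℝ :=
  backup M β h s a (optVal M β (h + 1))

theorem optVal_eq (M : MDP S A H) (β : ℝ) {h : ℕ} (hh : h ≤ H) (s : S) :
    optVal M β h s = Finset.univ.sup' Finset.univ_nonempty (optQ M β h s) := by
  have e : H + 1 - h = (H + 1 - (h + 1)) + 1 := by omega
  unfold optQ optVal
  rw [e, optValAux]

theorem optQ_le_optVal (M : MDP S A H) (β : ℝ) {h : ℕ} (hh : h ≤ H) (s : S) (a : A) :
    optQ M β h s a ≤ optVal M β h s := by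
  rw [optVal_eq M β hh]
  exact Finset.le_sup' (optQ M β h s) (Finset.mem_univ a)

theorem optVal_last (M : MDP S A H) (β : ℝ) (s : S) : optVal M β (H + 1) s = sgn β := by
  simp [optVal, optValAux]

theorem optVal_mem (M : MDP S A H) (β : ℝ) : ∀ h ∈ Finset.Icc 1 (H + 1), ∀ s,
    optVal M β h s ∈ Set.Icc (util β 0) (util β ((H : ℝ) - h + 1)) := by
  refine backward_induction ?_ ?_
  · intro s
    rw [optVal_last, util_zero]
    refine ⟨le_rfl, ?_⟩
    rw [← util_zero]
    exact util_mono β (by push_cast; linarith)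
  · intro h hh ih s
    rw [optVal_eq M β (Finset.mem_Icc.1 hh).2]
    have key : ∀ a, optQ M β h s a ∈ Set.Icc (util β 0) (util β ((H : ℝ) - h + 1)) := by
      intro a
      have := backup_mem M β hh s a ih
      rwa [show (H : ℝ) - (h + 1 : ℕ) + 1 + 1 = (H : ℝ) - h + 1 by push_cast; ring] at this
    obtain ⟨a⟩ := ‹Nonempty A›
    exact ⟨(key a).1.trans (Finset.le_sup' _ (Finset.mem_univ a)),
      Finset.sup'_le _ _ fun a _ => (key a).2⟩

theorem optVal_succ_mem (M : MDP S A H) (β : ℝ) {h : ℕ} (hh : h ∈ Finset.Icc 1 H) (s : S) :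
    optVal M β (h + 1) s ∈ Set.Icc (util β 0) (util β ((H : ℝ) - h)) := by
  have := optVal_mem M β (h + 1) (by simp only [Finset.mem_Icc] at *; omega) s
  rwa [show (H : ℝ) - (h + 1 : ℕ) + 1 = (H : ℝ) - h by push_cast; ring] at this

theorem optQ_mem (M : MDP S A H) (β : ℝ) {h : ℕ} (hh : h ∈ Finset.Icc 1 H) (s : S) (a : A) :
    optQ M β h s a ∈ Set.Icc (util β 0) (util β ((H : ℝ) - h + 1)) :=
  backup_mem M β hh s a (optVal_succ_mem M β hh)

theorem policyVal_le_optVal (M : MDP S A H) (β : ℝ) (π : Policy S A) :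
    ∀ h ∈ Finset.Icc 1 (H + 1), ∀ s, policyVal M β π h s ≤ optVal M β h s := by
  refine backward_induction ?_ ?_
  · intro s
    rw [policyVal_last, optVal_last]
  · intro h hh ih s
    have hH := (Finset.mem_Icc.1 hh).2
    rw [policyVal_eq M β π hH]
    exact (backup_mono M β h s _ ih).trans (optQ_le_optVal M β hH s _)

/-- The factor `max(1, e^{-βH})` lost by inverting `util`. -/
def invLip (β : ℝ) (H : ℕ) : ℝ := max 1 (Real.exp (-(β * H)))

/-- From log z ≤ z - 1 applied to the ratio of the larger to the smaller argument. The smaller one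
is at least 1 if β > 0 and at least e^{βH} if β < 0, which is where `invLip` comes from. -/
theorem log_sgn_sub_le {β : ℝ} (hβ : β ≠ 0) {H : ℕ} {x y : ℝ}
    (hx : x ∈ Set.Icc (util β 0) (util β H)) (hxy : x ≤ y) (hy : y ≤ util β H) :
    1 / β * Real.log (sgn β * y) - 1 / β * Real.log (sgn β * x) ≤ invLip β H / |β| * (y - x) := by
  have hx' := sgn_mul_nonneg hx
  have hy' := sgn_mul_nonneg (n := H) ⟨hx.1.trans hxy, hy⟩
  have h0 := hx.1
  rw [util_zero] at h0
  have hL1 : 1 ≤ invLip β H := le_max_left _ _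
  have hL2 : Real.exp (-(β * H)) ≤ invLip β H := le_max_right _ _
  unfold util at hy
  unfold sgn at *
  split_ifs at * with h
  · rw [one_mul, one_mul] at *
    rw [abs_of_pos h, ← mul_sub, ← Real.log_div hy'.ne' hx'.ne']
    have h1 : Real.log (y / x) ≤ y / x - 1 := Real.log_le_sub_one_of_pos (div_pos hy' hx')
    have h2 : y / x - 1 ≤ y - x := by
      rw [div_sub_one hx'.ne', div_le_iff₀ hx']
      nlinarith
    have h3 : y - x ≤ invLip β H * (y - x) := by nlinarith
    calc 1 / β * Real.log (y / x) ≤ 1 / β * (invLip β H * (y - x)) :=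
          mul_le_mul_of_nonneg_left (by linarith) (by positivity)
      _ = _ := by ring
  · have hβ' : β < 0 := lt_of_le_of_ne (not_lt.1 h) hβ
    simp only [neg_one_mul] at *
    have e : 1 / β * Real.log (-y) - 1 / β * Real.log (-x) =
        1 / |β| * Real.log (-x / -y) := by
      rw [abs_of_neg hβ', Real.log_div hx'.ne' hy'.ne']
      field_simp
      ring
    rw [e]
    have h1 : Real.log (-x / -y) ≤ -x / -y - 1 := Real.log_le_sub_one_of_pos (div_pos hx' hy')
    have hE : Real.exp (-(β * H)) * Real.exp (β * H) = 1 := by rw [← Real.exp_add]; simp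
    have h2 : -x / -y - 1 ≤ invLip β H * (y - x) := by
      rw [div_sub_one hy'.ne', div_le_iff₀ hy']
      have h4 : 1 ≤ invLip β H * (-y) := by
        rw [← hE]
        exact mul_le_mul hL2 (by linarith) (Real.exp_pos _).le (by linarith)
      nlinarith
    calc 1 / |β| * Real.log (-x / -y) ≤ 1 / |β| * (invLip β H * (y - x)) :=
          mul_le_mul_of_nonneg_left (by linarith) (by positivity)
      _ = _ := by ring

/-- The supremum only has to be bounded above by the solution of the optimality recursion; that some
policy attains it is not needed. -/
theorem optValue_sub_value_le (M : MDP S A H) {β : ℝ} (hβ : β ≠ 0) (π : Policy S A) (s : S) :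
    M.optValue β 1 s - M.value β π 1 s ≤
      invLip β H / |β| * (optVal M β 1 s - policyVal M β π 1 s) := by
  have h1 : 1 ∈ Finset.Icc 1 (H + 1) := by simp
  have eH : (H : ℝ) - (1 : ℕ) + 1 = H := by push_cast; ring
  have hp := fun π => policyVal_mem M β π 1 h1 s
  have ho := optVal_mem M β 1 h1 s
  rw [eH] at ho
  simp only [eH] at hp
  refine le_trans ?_ (log_sgn_sub_le hβ (hp π) (policyVal_le_optVal M β π 1 h1 s) ho.2)
  rw [value_eq M β π h1]
  refine sub_le_sub_right ?_ _
  have : Nonempty (Policy S A) := ⟨fun _ _ => Classical.arbitrary A⟩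
  refine ciSup_le fun π' => ?_
  rw [value_eq M β π' h1]
  have hle := policyVal_le_optVal M β π' 1 h1 s
  have hp' := sgn_mul_nonneg (hp π')
  have ho' := sgn_mul_nonneg ho
  unfold sgn at *
  split_ifs at * with h
  · refine mul_le_mul_of_nonneg_left (Real.log_le_log hp' (by linarith)) (by positivity)
  · refine mul_le_mul_of_nonpos_left (Real.log_le_log ho' (by linarith)) ?_
    exact one_div_nonpos.2 (not_lt.1 h)

end OptimalValues


/-! ### Slack and noise of a triple -/

section Cells

variable {S A : Type*} {H : ℕ} [Fintype S] [Fintype A] [Nonempty A]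

/-- The gap between the largest conceivable value and the optimal action value, transformed. -/
def slack (M : MDP S A H) (β : ℝ) (h : ℕ) (s : S) (a : A) : ℝ :=
  util β ((H : ℝ) - h + 1) - optQ M β h s a

open scoped Classical in
/-- The deviation of the transformed optimal value of the next state from its mean, set to zero at
impossible transitions. -/
def noise (M : MDP S A H) (β : ℝ) (h : ℕ) (s : S) (a : A) (s' : S) : ℝ :=
  if M.P h s a s' = 0 then 0 else gain M β h s a * optVal M β (h + 1) s' - optQ M β h s a

theorem noise_of_ne (M : MDP S A H) (β : ℝ) {h : ℕ} {s : S} {a : A} {s' : S}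
    (hs : M.P h s a s' ≠ 0) :
    noise M β h s a s' = gain M β h s a * optVal M β (h + 1) s' - optQ M β h s a :=
  if_neg hs

theorem toReal_mul_noise (M : MDP S A H) (β : ℝ) (h : ℕ) (s : S) (a : A) (s' : S) :
    (M.P h s a s').toReal * noise M β h s a s' =
      (M.P h s a s').toReal * (gain M β h s a * optVal M β (h + 1) s' - optQ M β h s a) := by
  unfold noise
  split_ifs with h0 <;> simp [h0]

theorem sum_mul_gain_mul (M : MDP S A H) (β : ℝ) (h : ℕ) (s : S) (a : A) :
    ∑ s', (M.P h s a s').toReal * (gain M β h s a * optVal M β (h + 1) s') = optQ M β h s a := by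
  rw [optQ, backup, Finset.mul_sum]
  exact Finset.sum_congr rfl fun _ _ => by ring

theorem sum_mul_noise (M : MDP S A H) (β : ℝ) (h : ℕ) (s : S) (a : A) :
    ∑ s', (M.P h s a s').toReal * noise M β h s a s' = 0 := by
  simp only [toReal_mul_noise, mul_sub, Finset.sum_sub_distrib, sum_mul_gain_mul,
    ← Finset.sum_mul, sum_toReal]
  ring

theorem slack_nonneg (M : MDP S A H) (β : ℝ) {h : ℕ} (hh : h ∈ Finset.Icc 1 H) (s : S) (a : A) :
    0 ≤ slack M β h s a := sub_nonneg.2 (optQ_mem M β hh s a).2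

theorem gain_mul_optVal_mem (M : MDP S A H) (β : ℝ) {h : ℕ} (hh : h ∈ Finset.Icc 1 H) (s : S)
    (a : A) (s' : S) : gain M β h s a * optVal M β (h + 1) s' ∈
      Set.Icc (util β 0) (util β ((H : ℝ) - h + 1)) :=
  gain_mul_mem M β hh s a (optVal_succ_mem M β hh s')

theorem util_sub_le (β : ℝ) {h : ℕ} (hh : h ∈ Finset.Icc 1 H) :
    util β ((H : ℝ) - h + 1) - util β 0 ≤ |Real.exp (β * H) - 1| := by
  rw [← util_sub_util_zero (Nat.cast_nonneg H)]
  have : (1 : ℝ) ≤ h := by exact_mod_cast (Finset.mem_Icc.1 hh).1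
  have := util_mono β (show (H : ℝ) - h + 1 ≤ H by linarith)
  linarith

theorem slack_le (M : MDP S A H) (β : ℝ) {h : ℕ} (hh : h ∈ Finset.Icc 1 H) (s : S) (a : A) :
    slack M β h s a ≤ |Real.exp (β * H) - 1| := by
  have := (optQ_mem M β hh s a).1
  have := util_sub_le β hh
  unfold slack
  linarith

theorem abs_noise_le (M : MDP S A H) (β : ℝ) {h : ℕ} (hh : h ∈ Finset.Icc 1 H) (s : S) (a : A)
    (s' : S) : |noise M β h s a s'| ≤ |Real.exp (β * H) - 1| := by
  unfold noise
  split_ifs with h0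
  · simp
  · obtain ⟨h1, h2⟩ := gain_mul_optVal_mem M β hh s a s'
    obtain ⟨h3, h4⟩ := optQ_mem M β hh s a
    have := util_sub_le β hh
    rw [abs_le]
    constructor <;> linarith

/-- With zero slack the mean of the target equals its largest conceivable value, so every possible
next state attains it. Impossible ones have zero noise by definition. -/
theorem noise_eq_zero (M : MDP S A H) (β : ℝ) {h : ℕ} (hh : h ∈ Finset.Icc 1 H) {s : S} {a : A}
    (h0 : slack M β h s a = 0) (s' : S) : noise M β h s a s' = 0 := by
  have hs : ∑ s', (M.P h s a s').toReal *
      (util β ((H : ℝ) - h + 1) - gain M β h s a * optVal M β (h + 1) s') = 0 := by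
    simp only [mul_sub, Finset.sum_sub_distrib, sum_mul_gain_mul, ← Finset.sum_mul, sum_toReal,
      one_mul]
    exact h0
  rw [Finset.sum_eq_zero_iff_of_nonneg fun s' _ => mul_nonneg ENNReal.toReal_nonneg
    (sub_nonneg.2 (gain_mul_optVal_mem M β hh s a s').2)] at hs
  have := hs s' (Finset.mem_univ s')
  unfold noise
  split_ifs with hP
  · rfl
  · rcases mul_eq_zero.1 this with h1 | h1
    · exact absurd ((ENNReal.toReal_eq_zero_iff _).1 h1) (by simp [hP, PMF.apply_ne_top])
    · unfold slack at h0
      linarith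

end Cells

/-! ### Size and summation of the bonuses -/

section Bonus

variable (S A : Type*) [Fintype S] [Fintype A] {H : ℕ}

theorem bonus_nonneg {p : Params} (hc : 0 ≤ p.c) (t : ℕ) : 0 ≤ bonus S A H p t := by
  unfold bonus
  positivity

theorem bonus_anti {p : Params} (hc : 0 ≤ p.c) (hι : 0 ≤ logFactor S A H p.K p.δ) {j t : ℕ}
    (hj : 1 ≤ j) (hjt : j ≤ t) : bonus S A H p t ≤ bonus S A H p j := by
  have h1 : (0 : ℝ) < j := by exact_mod_cast hj
  have h2 : (j : ℝ) ≤ t := by exact_mod_cast hjt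
  unfold bonus
  gcongr

theorem bonus_le {p : Params} (hc : 0 ≤ p.c) (n : ℕ) :
    bonus S A H p (n + 1) ≤ 2 * p.c * |Real.exp (p.β * H) - 1| *
      √((H : ℝ) * logFactor S A H p.K p.δ) * (√((n + 1 : ℕ) : ℝ) - √(n : ℝ)) := by
  have h0 : (0 : ℝ) < √((n + 1 : ℕ) : ℝ) := Real.sqrt_pos.2 (by positivity)
  have h1 : √(n : ℝ) ^ 2 = n := Real.sq_sqrt (by positivity)
  have h2 : √((n + 1 : ℕ) : ℝ) ^ 2 = (n : ℝ) + 1 := by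
    rw [Real.sq_sqrt (by positivity)]; push_cast; ring
  -- This comparison makes the sum of the bonuses telescope.
  have h3 : 1 / √((n + 1 : ℕ) : ℝ) ≤ 2 * (√((n + 1 : ℕ) : ℝ) - √(n : ℝ)) := by
    rw [div_le_iff₀ h0]
    nlinarith [sq_nonneg (√((n + 1 : ℕ) : ℝ) - √(n : ℝ))]
  unfold bonus
  rw [Real.sqrt_div' _ (by positivity), div_eq_mul_one_div]
  calc _ = p.c * |Real.exp (p.β * H) - 1| * √((H : ℝ) * logFactor S A H p.K p.δ) *
          (1 / √((n + 1 : ℕ) : ℝ)) := by ring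
    _ ≤ p.c * |Real.exp (p.β * H) - 1| * √((H : ℝ) * logFactor S A H p.K p.δ) *
          (2 * (√((n + 1 : ℕ) : ℝ) - √(n : ℝ))) :=
        mul_le_mul_of_nonneg_left h3 (by positivity)
    _ = _ := by ring

end Bonus

theorem util_log {β y : ℝ} (hβ : β ≠ 0) (hy : 0 < y) : util β (1 / β * Real.log y) = sgn β * y := by
  unfold util
  rw [← mul_assoc, mul_one_div_cancel hβ, one_mul, Real.exp_log hy]

/-! ### The update in the transformed scale, and optimism -/

section Update

variable {S A : Type*} {H : ℕ} [Fintype S] [Fintype A]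

/-- For β < 0 the factor -1 turns the maximum into a minimum and the subtracted bonus into an added
one, so both signs of β obey one recursion. -/
theorem util_newQ (M : MDP S A H) {p : Params} (hβ : p.β ≠ 0) (hc : 0 ≤ p.c) (m : Memory S A)
    (h : ℕ) (s : S) (a : A) (s' : S) :
    util p.β (newQ M p m h s a s') = min (util p.β ((H : ℝ) - h + 1))
      ((1 - learnRate H (m.N h s a + 1)) * util p.β (m.Q h s a) + learnRate H (m.N h s a + 1) *
        (gain M p.β h s a * util p.β (m.V (h + 1) s') + bonus S A H p (m.N h s a + 1))) := by
  have h1 := one_sub_learnRate_nonneg H (m.N h s a + 1) (by omega)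
  have h2 := learnRate_pos H (m.N h s a + 1) (by omega)
  have h3 := bonus_nonneg S A (H := H) hc (m.N h s a + 1)
  unfold newQ gain
  rw [exp_mul_util]
  simp only
  set α := learnRate H (m.N h s a + 1)
  set b := bonus S A H p (m.N h s a + 1)
  split_ifs with hp
  · have hw : 0 < (1 - α) * Real.exp (p.β * m.Q h s a) +
        α * Real.exp (p.β * (M.r h s a + m.V (h + 1) s')) + α * b := by positivity
    rw [util_log hβ (lt_min (Real.exp_pos _) hw)]
    simp only [util, sgn, if_pos hp, one_mul]
    congr 1
    ring
  · rw [util_log hβ (lt_of_lt_of_le (Real.exp_pos _) (le_max_left _ _))]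
    simp only [util, sgn, if_neg hp, neg_one_mul, ← min_neg_neg]
    congr 1
    ring

variable [DecidableEq S] [DecidableEq A] [Nonempty A]

theorem update_Q (M : MDP S A H) (p : Params) (m : Memory S A) (h : ℕ) (s : S) (a : A) (s' : S)
    (h₁ : ℕ) (s₁ : S) (a₁ : A) : (update M p m h s a s').Q h₁ s₁ a₁ =
      if h = h₁ ∧ s = s₁ ∧ a = a₁ then newQ M p m h s a s' else m.Q h₁ s₁ a₁ := by
  unfold update
  by_cases e1 : h₁ = h
  · subst e1
    by_cases e2 : s₁ = s
    · subst e2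
      by_cases e3 : a₁ = a
      · subst e3; simp
      · simp [e3, Ne.symm e3]
    · simp [e2, Ne.symm e2]
  · simp [e1, Ne.symm e1]

theorem update_N (M : MDP S A H) (p : Params) (m : Memory S A) (h : ℕ) (s : S) (a : A) (s' : S)
    (h₁ : ℕ) (s₁ : S) (a₁ : A) : (update M p m h s a s').N h₁ s₁ a₁ =
      if h = h₁ ∧ s = s₁ ∧ a = a₁ then m.N h s a + 1 else m.N h₁ s₁ a₁ := by
  unfold update
  by_cases e1 : h₁ = h
  · subst e1
    by_cases e2 : s₁ = s
    · subst e2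
      by_cases e3 : a₁ = a
      · subst e3; simp
      · simp [e3, Ne.symm e3]
    · simp [e2, Ne.symm e2]
  · simp [e1, Ne.symm e1]

theorem update_Q_of_ne (M : MDP S A H) (p : Params) (m : Memory S A) {h : ℕ} (s : S) (a : A)
    (s' : S) {h₁ : ℕ} (hne : h₁ ≠ h) : (update M p m h s a s').Q h₁ = m.Q h₁ := by
  simp [update, hne]

theorem update_V_of_ne (M : MDP S A H) (p : Params) (m : Memory S A) {h : ℕ} (s : S) (a : A)
    (s' : S) {h₁ : ℕ} (hne : h₁ ≠ h) : (update M p m h s a s').V h₁ = m.V h₁ := by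
  simp [update, hne]

/-- The next states observed at the visits of `(s, a)` at step `h`, latest first. -/
def observed (h : ℕ) (s : S) (a : A) : List (Transition S A) → List S
  | [] => []
  | x :: l => if x.2.1 = h ∧ x.2.2.1 = s ∧ x.2.2.2.1 = a then x.2.2.2.2 :: observed h s a l
      else observed h s a l

/-- The noise observed so far has never brought one of the reflected recursions below zero. -/
def GoodHistory (M : MDP S A H) (p : Params) (l : List (Transition S A)) : Prop :=
  ∀ h ∈ Finset.Icc 1 H, ∀ s a,
    StaysNonneg H (bonus S A H p) (slack M p.β h s a) (noise M p.β h s a) (observed h s a l)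

theorem GoodHistory.of_cons {M : MDP S A H} {p : Params} {x : Transition S A}
    {l : List (Transition S A)} (hl : GoodHistory M p (x :: l)) : GoodHistory M p l := by
  intro h hh s a
  have := hl h hh s a
  unfold observed at this
  split_ifs at this
  · exact this.2
  · exact this

theorem GoodHistory.of_push {M : MDP S A H} {p : Params} {π : Policy S A} {xs : List (S × A × S)} :
    ∀ {h : ℕ} {l : List (Transition S A)}, GoodHistory M p (push π h xs l) →
      GoodHistory M p l := by
  induction xs with
  | nil => exact fun hl => hl
  | cons x xs ih => exact fun hl => (ih hl).of_cons

/-- What the memory remembers of the history. On good histories the estimates are optimistic. -/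
structure MemoryInv (M : MDP S A H) (p : Params) (m : Memory S A) (l : List (Transition S A)) :
    Prop where
  V_eq : ∀ h ≤ H, ∀ s, m.V h s = Finset.univ.sup' Finset.univ_nonempty (m.Q h s)
  V_last : ∀ s, m.V (H + 1) s = 0
  N_eq : ∀ h s a, m.N h s a = (observed h s a l).length
  le_Q : GoodHistory M p l → ∀ h ∈ Finset.Icc 1 H, ∀ s a, optQ M p.β h s a +
    reflect H (bonus S A H p) (slack M p.β h s a) (noise M p.β h s a) (observed h s a l) ≤
      util p.β (m.Q h s a)

namespace MemoryInv

variable {M : MDP S A H} {p : Params} {m : Memory S A} {l : List (Transition S A)}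

theorem init (M : MDP S A H) (p : Params) : MemoryInv M p (Memory.init S A H) [] where
  V_eq h hh s := by simp [Memory.init]
  V_last s := by simp [Memory.init]
  N_eq h s a := by simp [Memory.init, observed]
  le_Q _ h hh s a := by
    simp [Memory.init, observed, reflect, slack, (Finset.mem_Icc.1 hh).2]

theorem Q_le_V (hm : MemoryInv M p m l) {h : ℕ} (hh : h ≤ H) (s : S) (a : A) :
    m.Q h s a ≤ m.V h s := by
  rw [hm.V_eq h hh]
  exact Finset.le_sup' (m.Q h s) (Finset.mem_univ a)

theorem optQ_le (hm : MemoryInv M p m l) (hl : GoodHistory M p l) {h : ℕ}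
    (hh : h ∈ Finset.Icc 1 H) (s : S) (a : A) : optQ M p.β h s a ≤ util p.β (m.Q h s a) := by
  have h1 := hm.le_Q hl h hh s a
  have h2 := (hl h hh s a).reflect_nonneg (slack_nonneg M p.β hh s a)
  linarith

theorem optVal_le (hm : MemoryInv M p m l) (hl : GoodHistory M p l) {h : ℕ}
    (hh : h ∈ Finset.Icc 1 (H + 1)) (s : S) : optVal M p.β h s ≤ util p.β (m.V h s) := by
  rw [Finset.mem_Icc] at hh
  rcases hh.2.eq_or_lt with rfl | hlt
  · rw [hm.V_last, optVal_last, util_zero]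
  · have hh' : h ∈ Finset.Icc 1 H := Finset.mem_Icc.2 ⟨hh.1, by omega⟩
    rw [optVal_eq M p.β (by omega)]
    exact Finset.sup'_le _ _ fun a _ => (hm.optQ_le hl hh' s a).trans
      (util_mono p.β (hm.Q_le_V (by omega) s a))

/-- The target uses the value at step h+1, which is optimistic on the shorter history. Subtracting
the optimal action value turns the cap into the slack and makes the excess of the target at least
the noise; that s' is possible ensures the noise is the true deviation. -/
theorem update (hm : MemoryInv M p m l) (hβ : p.β ≠ 0) (hc : 0 ≤ p.c) (π : Policy S A) {h : ℕ}
    (hh : h ∈ Finset.Icc 1 H) {s : S} {a : A} {s' : S} (hs : M.P h s a s' ≠ 0) :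
    MemoryInv M p (RSQ.update M p m h s a s') ((π, h, s, a, s') :: l) where
  V_eq h₁ hh₁ s₁ := by
    by_cases e : h₁ = h
    · subst e
      by_cases e' : s₁ = s
      · subst e'; simp [RSQ.update]
      · simp [RSQ.update, e', hm.V_eq h₁ hh₁]
    · rw [update_V_of_ne _ _ _ _ _ _ e, update_Q_of_ne _ _ _ _ _ _ e, hm.V_eq h₁ hh₁]
  V_last s₁ := by
    rw [update_V_of_ne _ _ _ _ _ _ (by have := (Finset.mem_Icc.1 hh).2; omega), hm.V_last]
  N_eq h₁ s₁ a₁ := by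
    rw [update_N, observed]
    simp only
    split_ifs with e
    · obtain ⟨rfl, rfl, rfl⟩ := e
      rw [hm.N_eq, List.length_cons]
    · exact hm.N_eq _ _ _
  le_Q hl h₁ hh₁ s₁ a₁ := by
    have hl' := hl.of_cons
    rw [update_Q, observed]
    simp only
    split_ifs with e
    · obtain ⟨rfl, rfl, rfl⟩ := e
      rw [util_newQ M hβ hc, reflect, ← hm.N_eq, noise_of_ne M p.β hs]
      have h1 := one_sub_learnRate_nonneg H (m.N h s a + 1) (by omega)
      have h2 := learnRate_pos H (m.N h s a + 1) (by omega)
      have h3 := mul_le_mul_of_nonneg_left (hm.le_Q hl' h hh s a) h1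
      have h4 := mul_le_mul_of_nonneg_left (mul_le_mul_of_nonneg_left
        (hm.optVal_le hl' (h := h + 1) (by simp only [Finset.mem_Icc] at *; omega) s')
        (gain_pos M p.β h s a).le) h2.le
      rw [← min_add_add_left]
      refine min_le_min (by unfold slack; linarith) ?_
      linarith
    · exact hm.le_Q hl' h₁ hh₁ s₁ a₁

end MemoryInv

end Update


/-! ### Error weights and martingale differences -/

section Drift

variable {S A : Type*} {H : ℕ}

/-- The growth factor of the error per step. -/
def stepGain (β : ℝ) (H : ℕ) : ℝ := (1 + 1 / (H : ℝ)) * maxGain β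

theorem one_le_stepGain (β : ℝ) (H : ℕ) : 1 ≤ stepGain β H := by
  have h1 := one_le_maxGain β
  have h2 : (0 : ℝ) ≤ 1 / (H : ℝ) := by positivity
  unfold stepGain
  nlinarith

theorem gain_le_stepGain (M : MDP S A H) (β : ℝ) {h : ℕ} (hh : h ∈ Finset.Icc 1 H) (s : S)
    (a : A) : (1 + 1 / (H : ℝ)) * gain M β h s a ≤ stepGain β H :=
  mul_le_mul_of_nonneg_left (gain_le_maxGain M β hh s a) (by positivity)

theorem gain_le_stepGain' (M : MDP S A H) (β : ℝ) {h : ℕ} (hh : h ∈ Finset.Icc 1 H) (s : S)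
    (a : A) : gain M β h s a ≤ stepGain β H := by
  refine le_trans ?_ (gain_le_stepGain M β hh s a)
  have h2 : (0 : ℝ) ≤ 1 / (H : ℝ) := by positivity
  nlinarith [gain_pos M β h s a]

/-- The weight of the errors at step `h` in the regret. -/
def weight (β : ℝ) (H h : ℕ) : ℝ := stepGain β H ^ (h - 1)

theorem weight_pos (β : ℝ) (H h : ℕ) : 0 < weight β H h :=
  pow_pos (by linarith [one_le_stepGain β H]) _

theorem weight_one (β : ℝ) (H : ℕ) : weight β H 1 = 1 := by simp [weight]

theorem weight_succ (β : ℝ) {H h : ℕ} (hh : 1 ≤ h) :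
    weight β H (h + 1) = weight β H h * stepGain β H := by
  obtain ⟨k, rfl⟩ := Nat.exists_eq_add_of_le' hh
  simp [weight, pow_succ]

theorem weight_le (β : ℝ) {H h : ℕ} (hh : h ∈ Finset.Icc 1 H) :
    weight β H h ≤ stepGain β H ^ (H - 1) :=
  pow_le_pow_right₀ (one_le_stepGain β H) (by have := (Finset.mem_Icc.1 hh).2; omega)

variable [Fintype S] [Fintype A] [Nonempty A]

/-- The part of the error of an episode that depends on the sampled next state. -/
def tilt (M : MDP S A H) (β : ℝ) (π : Policy S A) (h : ℕ) (s : S) (a : A) (s' : S) : ℝ :=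
  weight β H h * ((1 + 1 / (H : ℝ)) * (gain M β h s a * optVal M β (h + 1) s') -
    stepGain β H * (optVal M β (h + 1) s' - policyVal M β π (h + 1) s'))

/-- The martingale difference of the error at a transition. -/
def drift (M : MDP S A H) (β : ℝ) (π : Policy S A) (h : ℕ) (s : S) (a : A) (s' : S) : ℝ :=
  tilt M β π h s a s' - ∑ x, (M.P h s a x).toReal * tilt M β π h s a x

theorem sum_mul_drift (M : MDP S A H) (β : ℝ) (π : Policy S A) (h : ℕ) (s : S) (a : A) :
    ∑ s', (M.P h s a s').toReal * drift M β π h s a s' = 0 := by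
  simp only [drift, mul_sub, Finset.sum_sub_distrib, ← Finset.sum_mul, sum_toReal]
  ring

theorem drift_eq (M : MDP S A H) (β : ℝ) (π : Policy S A) (h : ℕ) (s : S) (a : A) (s' : S) :
    drift M β π h s a s' = weight β H h *
      ((1 + 1 / (H : ℝ)) * (gain M β h s a * optVal M β (h + 1) s' - optQ M β h s a) -
        stepGain β H * ((optVal M β (h + 1) s' - policyVal M β π (h + 1) s') -
          ∑ x, (M.P h s a x).toReal * (optVal M β (h + 1) x - policyVal M β π (h + 1) x))) := by
  have e : ∑ x, (M.P h s a x).toReal * tilt M β π h s a x =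
      weight β H h * ((1 + 1 / (H : ℝ)) *
        (∑ x, (M.P h s a x).toReal * (gain M β h s a * optVal M β (h + 1) x)) -
        stepGain β H * ∑ x, (M.P h s a x).toReal *
          (optVal M β (h + 1) x - policyVal M β π (h + 1) x)) := by
    simp only [tilt, Finset.mul_sum, ← Finset.sum_sub_distrib]
    exact Finset.sum_congr rfl fun _ _ => by ring
  rw [drift, e, sum_mul_gain_mul, tilt]
  ring

/-- A bound on the martingale differences. -/
def driftBound (β : ℝ) (H : ℕ) : ℝ := 6 * stepGain β H ^ H * Real.exp (|β| * H)

theorem driftBound_pos (β : ℝ) (H : ℕ) : 0 < driftBound β H := by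
  have := one_le_stepGain β H
  unfold driftBound
  positivity

theorem abs_drift_le (M : MDP S A H) (β : ℝ) (π : Policy S A) {h : ℕ} (hh : h ∈ Finset.Icc 1 H)
    (s : S) (a : A) (s' : S) : |drift M β π h s a s'| ≤ driftBound β H := by
  have hh' := Finset.mem_Icc.1 hh
  have hh1 : h + 1 ∈ Finset.Icc 1 (H + 1) := Finset.mem_Icc.2 ⟨by omega, by omega⟩
  have hb : ∀ x, x ∈ Set.Icc (util β 0) (util β ((H : ℝ) - (h + 1 : ℕ) + 1)) →
      |x| ≤ Real.exp (|β| * H) := by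
    intro x hx
    have h0 : (h : ℝ) ≤ H := by exact_mod_cast hh'.2
    have h1 := abs_util_le (β := β) (H := H) (le_refl 0) (Nat.cast_nonneg H)
    have h2 := abs_util_le (β := β) (H := H) (x := (H : ℝ) - (h + 1 : ℕ) + 1)
      (by push_cast; linarith) (by push_cast; linarith [(Nat.cast_nonneg h : (0 : ℝ) ≤ h)])
    exact abs_le.2 ⟨by linarith [(abs_le.1 h1).1, hx.1], by linarith [(abs_le.1 h2).2, hx.2]⟩
  have hG := one_le_stepGain β H
  have ht : ∀ x, |tilt M β π h s a x| ≤ 3 * stepGain β H ^ H * Real.exp (|β| * H) := by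
    intro x
    have h1 := hb _ (optVal_mem M β (h + 1) hh1 x)
    have h2 := hb _ (policyVal_mem M β π (h + 1) hh1 x)
    have hg := gain_le_stepGain M β hh s a
    have hg0 : 0 ≤ (1 + 1 / (H : ℝ)) * gain M β h s a :=
      mul_nonneg (by positivity) (gain_pos _ _ _ _ _).le
    rw [tilt, abs_mul, abs_of_pos (weight_pos β H h), ← mul_assoc]
    have h3 : |(1 + 1 / (H : ℝ)) * gain M β h s a * optVal M β (h + 1) x| ≤
        stepGain β H * Real.exp (|β| * H) := by
      rw [abs_mul, abs_of_nonneg hg0]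
      exact mul_le_mul hg h1 (abs_nonneg _) (by linarith)
    have h4 : |stepGain β H * (optVal M β (h + 1) x - policyVal M β π (h + 1) x)| ≤
        stepGain β H * (2 * Real.exp (|β| * H)) := by
      rw [abs_mul, abs_of_nonneg (by linarith : 0 ≤ stepGain β H)]
      exact mul_le_mul_of_nonneg_left ((abs_sub _ _).trans (by linarith)) (by linarith)
    have hw : weight β H h * stepGain β H ≤ stepGain β H ^ H := by
      rw [← weight_succ β hh'.1, weight]
      exact pow_le_pow_right₀ hG (by omega)
    calc _ ≤ weight β H h * (stepGain β H * Real.exp (|β| * H) +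
          stepGain β H * (2 * Real.exp (|β| * H))) :=
          mul_le_mul_of_nonneg_left ((abs_sub _ _).trans (by linarith)) (weight_pos _ _ _).le
      _ = 3 * (weight β H h * stepGain β H) * Real.exp (|β| * H) := by ring
      _ ≤ _ := by gcongr
  have h1 := abs_le.1 (ht s')
  have h2 := avg_le (M.P h s a) fun x => (abs_le.1 (ht x)).2
  have h3 := le_avg (M.P h s a) fun x => (abs_le.1 (ht x)).1
  unfold drift driftBound
  rw [abs_le]
  constructor <;> linarith

/-- The sum of the martingale differences along a history. -/
def driftSum (M : MDP S A H) (β : ℝ) : List (Transition S A) → ℝ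
  | [] => 0
  | x :: l => drift M β x.1 x.2.1 x.2.2.1 x.2.2.2.1 x.2.2.2.2 + driftSum M β l

end Drift

/-! ### The potential of the memory and the one-step error bound -/

section Potential

variable {S A : Type*} {H : ℕ} [Fintype S] [Fintype A] [Nonempty A]

/-- The total bonus of the first `n` visits is at most `bonusScale * √n`. -/
def bonusScale (S A : Type*) [Fintype S] [Fintype A] (H : ℕ) (p : Params) : ℝ :=
  2 * p.c * |Real.exp (p.β * H) - 1| * √((H : ℝ) * logFactor S A H p.K p.δ)

/-- The potential of the triple `(h, s, a)` after `n` visits, with transformed estimate `x`. -/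
def cellPot (M : MDP S A H) (p : Params) (h : ℕ) (s : S) (a : A) (n : ℕ) (x : ℝ) : ℝ :=
  weight p.β H h * (((n : ℝ) + H) / H * (x - optQ M p.β h s a) -
    (1 + 1 / (H : ℝ)) * (bonusScale S A H p * √(n : ℝ)))

/-- The potential of the memory. -/
def memoryPot (M : MDP S A H) (p : Params) (m : Memory S A) : ℝ :=
  ∑ x ∈ Finset.Icc 1 H ×ˢ (Finset.univ : Finset (S × A)),
    cellPot M p x.1 x.2.1 x.2.2 (m.N x.1 x.2.1 x.2.2) (util p.β (m.Q x.1 x.2.1 x.2.2))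

theorem cellPot_newQ (M : MDP S A H) {p : Params} (hβ : p.β ≠ 0) (hc : 0 ≤ p.c)
    (m : Memory S A) {h : ℕ} (hh : h ∈ Finset.Icc 1 H) (s : S) (a : A) (s' : S) :
    weight p.β H h * (util p.β (m.Q h s a) - optQ M p.β h s a) ≤
      cellPot M p h s a (m.N h s a) (util p.β (m.Q h s a)) -
        cellPot M p h s a (m.N h s a + 1) (util p.β (newQ M p m h s a s')) +
      weight p.β H h * ((1 + 1 / (H : ℝ)) *
        (gain M p.β h s a * util p.β (m.V (h + 1) s') - optQ M p.β h s a)) := by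
  have hH : (1 : ℝ) ≤ H := by
    have := Finset.mem_Icc.1 hh
    exact_mod_cast this.1.trans this.2
  set n := m.N h s a
  set x := util p.β (m.Q h s a)
  set q := optQ M p.β h s a
  set g := gain M p.β h s a * util p.β (m.V (h + 1) s')
  have hb := bonus_le S A (H := H) (p := p) hc n
  rw [← bonusScale] at hb
  have hx : util p.β (newQ M p m h s a s') ≤ (1 - learnRate H (n + 1)) * x +
      learnRate H (n + 1) * (g + bonus S A H p (n + 1)) :=
    (util_newQ M hβ hc m h s a s').le.trans (min_le_right _ _)
  set x' := util p.β (newQ M p m h s a s')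
  set b := bonus S A H p (n + 1)
  have hn : (0 : ℝ) ≤ n := Nat.cast_nonneg n
  -- The prefactor fits the learning rate: (n+1+H)/H times α_{n+1} is 1+1/H, and times 1-α_{n+1} it
  -- is n/H. Compared with (n+H)/H before the visit, exactly one copy of the error is released.
  have key : (((n + 1 : ℕ) : ℝ) + H) / H * (x' - q) ≤
      n / H * (x - q) + (1 + 1 / (H : ℝ)) * (g - q + b) := by
    calc (((n + 1 : ℕ) : ℝ) + H) / H * (x' - q) ≤ (((n + 1 : ℕ) : ℝ) + H) / H *
          ((1 - learnRate H (n + 1)) * x + learnRate H (n + 1) * (g + b) - q) :=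
          mul_le_mul_of_nonneg_left (by linarith) (by positivity)
      _ = _ := by
        rw [one_sub_learnRate H (n + 1) (by omega), learnRate]
        push_cast
        field_simp
        ring
  rw [cellPot, cellPot, ← mul_sub, ← mul_add]
  refine mul_le_mul_of_nonneg_left ?_ (weight_pos _ _ _).le
  have h1 : (1 + 1 / (H : ℝ)) * b ≤ (1 + 1 / (H : ℝ)) *
      (bonusScale S A H p * (√((n + 1 : ℕ) : ℝ) - √(n : ℝ))) :=
    mul_le_mul_of_nonneg_left hb (by positivity)
  have h2 : ((n : ℝ) + H) / H * (x - q) = n / H * (x - q) + (x - q) := by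
    field_simp
  rw [h2]
  linarith

variable [DecidableEq S] [DecidableEq A]

theorem memoryPot_update (M : MDP S A H) (p : Params) (m : Memory S A) {h : ℕ}
    (hh : h ∈ Finset.Icc 1 H) (s : S) (a : A) (s' : S) :
    memoryPot M p m - memoryPot M p (update M p m h s a s') =
      cellPot M p h s a (m.N h s a) (util p.β (m.Q h s a)) -
        cellPot M p h s a (m.N h s a + 1) (util p.β (newQ M p m h s a s')) := by
  have hmem : (h, s, a) ∈ Finset.Icc 1 H ×ˢ (Finset.univ : Finset (S × A)) := by simpa using hh
  unfold memoryPot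
  rw [← Finset.add_sum_erase _ _ hmem, ← Finset.add_sum_erase _ _ hmem]
  have : ∀ x ∈ (Finset.Icc 1 H ×ˢ (Finset.univ : Finset (S × A))).erase (h, s, a),
      cellPot M p x.1 x.2.1 x.2.2 ((update M p m h s a s').N x.1 x.2.1 x.2.2)
        (util p.β ((update M p m h s a s').Q x.1 x.2.1 x.2.2)) =
      cellPot M p x.1 x.2.1 x.2.2 (m.N x.1 x.2.1 x.2.2) (util p.β (m.Q x.1 x.2.1 x.2.2)) := by
    intro x hx
    have hne : ¬ (h = x.1 ∧ s = x.2.1 ∧ a = x.2.2) := by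
      rintro ⟨h1, h2, h3⟩
      exact (Finset.mem_erase.1 hx).1 (by rw [h1, h2, h3])
    rw [update_N, update_Q, if_neg hne, if_neg hne]
  rw [Finset.sum_congr rfl this, update_N, update_Q]
  simp

/-- The number of episodes recorded at step `h`. -/
def visits (m : Memory S A) (h : ℕ) : ℕ := ∑ x : S × A, m.N h x.1 x.2

theorem visits_update (M : MDP S A H) (p : Params) (m : Memory S A) (h : ℕ) (s : S) (a : A)
    (s' : S) (h₁ : ℕ) :
    visits (update M p m h s a s') h₁ = visits m h₁ + if h = h₁ then 1 else 0 := by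
  unfold visits
  simp only [update_N]
  split_ifs with e
  · subst e
    rw [← Finset.add_sum_erase _ _ (Finset.mem_univ (s, a)),
      ← Finset.add_sum_erase _ (fun x : S × A => m.N h x.1 x.2) (Finset.mem_univ (s, a))]
    have : ∀ x ∈ (Finset.univ : Finset (S × A)).erase (s, a),
        (if h = h ∧ s = x.1 ∧ a = x.2 then m.N h s a + 1 else m.N h x.1 x.2) =
        m.N h x.1 x.2 := by
      intro x hx
      refine if_neg ?_
      rintro ⟨-, h2, h3⟩
      exact (Finset.mem_erase.1 hx).1 (by rw [h2, h3])
    rw [Finset.sum_congr rfl this]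
    simp only [and_self, if_true]
    ring
  · simp [e]

/-- The error of a step is covered by the decrease of the potential, the martingale difference and
the error of the next step. -/
theorem error_step {M : MDP S A H} {p : Params} (hβ : p.β ≠ 0) (hc : 0 ≤ p.c) {m : Memory S A}
    {l : List (Transition S A)} (hm : MemoryInv M p m l) (hl : GoodHistory M p l)
    (π : Policy S A) {h : ℕ} (hh : h ∈ Finset.Icc 1 H) (s s' : S)
    (hπ : ∀ a, m.Q h s a ≤ m.Q h s (π h s)) :
    weight p.β H h * (util p.β (m.V h s) - policyVal M p.β π h s) ≤
      memoryPot M p m - memoryPot M p (update M p m h s (π h s) s') +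
      drift M p.β π h s (π h s) s' +
      weight p.β H (h + 1) * (util p.β (m.V (h + 1) s') - policyVal M p.β π (h + 1) s') := by
  have hh' := Finset.mem_Icc.1 hh
  have hh1 : h + 1 ∈ Finset.Icc 1 (H + 1) := Finset.mem_Icc.2 ⟨by omega, by omega⟩
  have hV : m.V h s = m.Q h s (π h s) := by
    refine le_antisymm ?_ (hm.Q_le_V hh'.2 s _)
    rw [hm.V_eq h hh'.2]
    exact Finset.sup'_le _ _ fun a _ => hπ a
  set a := π h s with ha
  have hcell := cellPot_newQ M hβ hc m hh s a s'
  rw [memoryPot_update M p m hh, drift_eq, weight_succ _ hh'.1, hV, policyVal_eq M _ π hh'.2,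
    ← ha]
  have hy : 0 ≤ util p.β (m.V (h + 1) s') - optVal M p.β (h + 1) s' :=
    sub_nonneg.2 (hm.optVal_le hl hh1 s')
  set D := ∑ x, (M.P h s a x).toReal *
    (optVal M p.β (h + 1) x - policyVal M p.β π (h + 1) x) with hD
  have hD0 : 0 ≤ D := Finset.sum_nonneg fun x _ => mul_nonneg ENNReal.toReal_nonneg
    (sub_nonneg.2 (policyVal_le_optVal M p.β π _ hh1 x))
  have hback : backup M p.β h s a (policyVal M p.β π (h + 1)) =
      optQ M p.β h s a - gain M p.β h s a * D := by
    rw [optQ, backup, backup, hD, ← mul_sub, ← Finset.sum_sub_distrib]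
    congr 1
    exact Finset.sum_congr rfl fun _ _ => by ring
  rw [hback]
  have hw := weight_pos p.β H h
  -- As D ≥ 0, the gain may be replaced by the uniform factor. The mean gap of the policy then
  -- cancels against the drift, and the sampled gap joins the next estimation error with the common
  -- weight at h+1.
  have h1 : weight p.β H h * (gain M p.β h s a * D) ≤ weight p.β H h * (stepGain p.β H * D) :=
    mul_le_mul_of_nonneg_left (mul_le_mul_of_nonneg_right (gain_le_stepGain' M p.β hh s a) hD0)
      hw.le
  have h2 := mul_le_mul_of_nonneg_left
    (mul_le_mul_of_nonneg_right (gain_le_stepGain M p.β hh s a) hy) hw.le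
  linarith

end Potential


/-! ### Summing the error bound along episodes -/

section Paths

variable {S A : Type*} {H : ℕ} [Fintype S] [Fintype A] [DecidableEq S] [DecidableEq A] [Nonempty A]

/-- An update at step h changes Q only at step h, so at later steps of the episode the current
estimates are still those for which π is greedy. This is why greediness is assumed only from step h
on. -/
theorem steps_inv {M : MDP S A H} {p : Params} (hβ : p.β ≠ 0) (hc : 0 ≤ p.c)
    {sel : ℕ → S → (A → ℝ) → A} (hsel : ∀ h s (q : A → ℝ) a, q a ≤ q (sel h s q))
    (π : Policy S A) (n : ℕ) : ∀ (h : ℕ) (s : S) (m : Memory S A) (l : List (Transition S A)),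
      1 ≤ h → h + n = H + 1 → MemoryInv M p m l →
      (∀ h₁, h ≤ h₁ → ∀ s, π h₁ s = sel h₁ s (m.Q h₁ s)) →
      ∀ y ∈ (steps M p sel n h s m).support,
        MemoryInv M p y.1 (push π h y.2 l) ∧ (push π h y.2 l).length = l.length + n ∧
        (∀ h₁, visits y.1 h₁ ≤ visits m h₁ + if h ≤ h₁ then 1 else 0) ∧
        (GoodHistory M p (push π h y.2 l) →
          weight p.β H h * (util p.β (m.V h s) - policyVal M p.β π h s) ≤
            memoryPot M p m - memoryPot M p y.1 +
              (driftSum M p.β (push π h y.2 l) - driftSum M p.β l)) := by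
  induction n with
  | zero =>
    intro h s m l h1 h2 hm hπ y hy
    rw [steps, PMF.support_pure, Set.mem_singleton_iff] at hy
    subst hy
    obtain rfl : h = H + 1 := by omega
    refine ⟨hm, rfl, fun h₁ => Nat.le_add_right _ _, fun _ => ?_⟩
    rw [hm.V_last, policyVal_last, util_zero]
    simp [push]
  | succ n ih =>
    intro h s m l h1 h2 hm hπ y hy
    have hh : h ∈ Finset.Icc 1 H := Finset.mem_Icc.2 ⟨h1, by omega⟩
    rw [steps, PMF.mem_support_bind_iff] at hy
    obtain ⟨s', hs', hy⟩ := hy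
    rw [PMF.support_map] at hy
    obtain ⟨x, hx, rfl⟩ := hy
    rw [← hπ h le_rfl s] at hs' hx ⊢
    rw [PMF.mem_support_iff] at hs'
    have hm' := hm.update hβ hc π hh hs'
    obtain ⟨i1, i2, i3, i4⟩ := ih (h + 1) s' _ _ (by omega) (by omega) hm'
      (fun h₁ hh₁ s₁ => by
        rw [update_Q_of_ne _ _ _ _ _ _ (by omega)]; exact hπ h₁ (by omega) s₁) x hx
    refine ⟨i1, ?_, fun h₁ => ?_, fun hl => ?_⟩
    · simp only [push]
      rw [i2, List.length_cons]
      omega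
    · refine (i3 h₁).trans ?_
      rw [visits_update]
      split_ifs <;> omega
    · have h4 := i4 hl
      have hl' : GoodHistory M p l := (GoodHistory.of_push (h := h) (π := π)
        (xs := (s, π h s, s') :: x.2) hl)
      have hstep := error_step hβ hc hm hl' π hh s s' (fun a => by
        rw [hπ h le_rfl s]; exact hsel _ _ _ _)
      rw [update_V_of_ne _ _ _ _ _ _ (by omega)] at h4
      simp only [push]
      simp only [driftSum] at h4
      linarith

/-- The transformed regret of a sequence of episodes. -/
def utilRegret (M : MDP S A H) (β : ℝ) (L : List (Episode S A)) : ℝ :=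
  (L.map fun e => optVal M β 1 e.initState - policyVal M β e.policy 1 e.initState).sum

omit [DecidableEq S] [DecidableEq A] in
theorem regret_le (M : MDP S A H) {β : ℝ} (hβ : β ≠ 0) (L : List (Episode S A)) :
    regret M β L ≤ invLip β H / |β| * utilRegret M β L := by
  unfold regret utilRegret
  induction L with
  | nil => simp
  | cons e L ih =>
    simp only [List.map_cons, List.sum_cons, mul_add]
    exact add_le_add (optValue_sub_value_le M hβ _ _) ih

theorem run_inv {M : MDP S A H} {p : Params} (hβ : p.β ≠ 0) (hc : 0 ≤ p.c)
    (env : List (Episode S A) → PMF S) {sel : List (Episode S A) → ℕ → S → (A → ℝ) → A}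
    (hsel : ∀ l h s (q : A → ℝ) a, q a ≤ q (sel l h s q)) (k : ℕ) :
    ∀ x ∈ (run M p env sel k).support,
      MemoryInv M p x.1 (history x.2) ∧ (history x.2).length = k * H ∧
      (∀ h, visits x.1 h ≤ k) ∧
      (GoodHistory M p (history x.2) → utilRegret M p.β x.2 ≤
        memoryPot M p (Memory.init S A H) - memoryPot M p x.1 +
          driftSum M p.β (history x.2)) := by
  induction k with
  | zero =>
    intro x hx
    rw [run, PMF.support_pure, Set.mem_singleton_iff] at hx
    subst hx
    refine ⟨MemoryInv.init M p, by simp [history], fun h => by simp [visits, Memory.init],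
      fun _ => by simp [utilRegret, history, driftSum]⟩
  | succ k ih =>
    intro x hx
    rw [run, PMF.mem_support_bind_iff] at hx
    obtain ⟨z, hz, hx⟩ := hx
    rw [PMF.mem_support_bind_iff] at hx
    obtain ⟨s, hs, hx⟩ := hx
    rw [PMF.support_map] at hx
    obtain ⟨y, hy, rfl⟩ := hx
    obtain ⟨j1, j2, j3, j4⟩ := ih z hz
    obtain ⟨i1, i2, i3, i4⟩ := steps_inv hβ hc (hsel z.2)
      (fun h s => sel z.2 h s (z.1.Q h s)) H 1 s z.1 (history z.2) le_rfl (by omega) j1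
      (fun _ _ _ => rfl) y hy
    simp only [history_concat]
    refine ⟨i1, by rw [i2, j2]; ring, fun h => ?_, fun hl => ?_⟩
    · refine (i3 h).trans ?_
      have := j3 h
      split_ifs <;> omega
    · have hl' := hl.of_push
      have h4 := j4 hl'
      have h5 := i4 hl
      rw [weight_one, one_mul] at h5
      -- Optimism at step 1 replaces the optimal value in the regret by the estimate that
      -- `steps_inv` controls.
      have h6 := j1.optVal_le hl' (h := 1) (by simp) s
      simp only [utilRegret, List.map_append, List.sum_append, List.map_cons, List.map_nil,
        List.sum_cons, List.sum_nil, add_zero] at h4 ⊢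
      linarith

omit [DecidableEq S] [DecidableEq A] in
theorem memoryPot_init_le (M : MDP S A H) (p : Params) (hH : 1 ≤ H) :
    memoryPot M p (Memory.init S A H) ≤ (H * Fintype.card (S × A) : ℕ) *
      (stepGain p.β H ^ (H - 1) * |Real.exp (p.β * H) - 1|) := by
  have hH' : (0 : ℝ) < H := by exact_mod_cast hH
  have hcard : (Finset.Icc 1 H ×ˢ (Finset.univ : Finset (S × A))).card =
      H * Fintype.card (S × A) := by
    rw [Finset.card_product, Nat.card_Icc, Finset.card_univ, Nat.add_sub_cancel]
  rw [memoryPot, ← hcard, ← nsmul_eq_mul]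
  refine Finset.sum_le_card_nsmul _ _ _ fun x hx => ?_
  have hx1 := (Finset.mem_product.1 hx).1
  have e : cellPot M p x.1 x.2.1 x.2.2 ((Memory.init S A H).N x.1 x.2.1 x.2.2)
      (util p.β ((Memory.init S A H).Q x.1 x.2.1 x.2.2)) =
      weight p.β H x.1 * slack M p.β x.1 x.2.1 x.2.2 := by
    simp [cellPot, Memory.init, (Finset.mem_Icc.1 hx1).2, slack, hH'.ne']
  rw [e]
  have h1 := one_le_stepGain p.β H
  exact mul_le_mul (weight_le _ hx1) (slack_le M _ hx1 _ _) (slack_nonneg M _ hx1 _ _)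
    (by positivity)

theorem sum_sqrt_le {X : Type*} [Fintype X] (N : X → ℕ) {K : ℕ} (hN : ∑ x, N x ≤ K) :
    ∑ x, √(N x : ℝ) ≤ √((Fintype.card X : ℝ) * K) := by
  refine Real.le_sqrt_of_sq_le ?_
  refine (sq_sum_le_card_mul_sum_sq (s := Finset.univ)).trans ?_
  rw [Finset.card_univ]
  refine mul_le_mul_of_nonneg_left ?_ (Nat.cast_nonneg _)
  simp only [Real.sq_sqrt (Nat.cast_nonneg _)]
  exact_mod_cast hN

/-- On a good history the error terms are nonnegative and can be dropped. The √n terms of each step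
are summed by Cauchy–Schwarz, since the visits of that step number at most k. -/
theorem neg_memoryPot_le {M : MDP S A H} {p : Params} (hc : 0 ≤ p.c) (hH : 1 ≤ H)
    {m : Memory S A} {l : List (Transition S A)} (hm : MemoryInv M p m l)
    (hl : GoodHistory M p l) {k : ℕ} (hk : ∀ h, visits m h ≤ k) :
    -memoryPot M p m ≤ H * (stepGain p.β H ^ (H - 1) * (2 * (bonusScale S A H p *
      √((Fintype.card (S × A) : ℝ) * k)))) := by
  have hH' : (1 : ℝ) ≤ H := by exact_mod_cast hH
  have hb : 0 ≤ bonusScale S A H p := by unfold bonusScale; positivity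
  have h2 : 1 + 1 / (H : ℝ) ≤ 2 := by
    have := (div_le_one (by linarith : (0 : ℝ) < H)).2 hH'
    linarith
  have hg := one_le_stepGain p.β H
  rw [memoryPot, Finset.sum_product, ← Finset.sum_neg_distrib]
  have hrow : ∀ h ∈ Finset.Icc 1 H, -∑ x : S × A, cellPot M p h x.1 x.2 (m.N h x.1 x.2)
      (util p.β (m.Q h x.1 x.2)) ≤ stepGain p.β H ^ (H - 1) * (2 * (bonusScale S A H p *
      √((Fintype.card (S × A) : ℝ) * k))) := by
    intro h hh
    have hw := weight_pos p.β H h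
    have hcell : ∀ x : S × A, -cellPot M p h x.1 x.2 (m.N h x.1 x.2)
        (util p.β (m.Q h x.1 x.2)) ≤
        stepGain p.β H ^ (H - 1) * (2 * (bonusScale S A H p * √(m.N h x.1 x.2 : ℝ))) := by
      intro x
      have h0 : 0 ≤ ((m.N h x.1 x.2 : ℝ) + H) / H *
          (util p.β (m.Q h x.1 x.2) - optQ M p.β h x.1 x.2) :=
        mul_nonneg (by positivity) (sub_nonneg.2 (hm.optQ_le hl hh _ _))
      have hbs : 0 ≤ bonusScale S A H p * √(m.N h x.1 x.2 : ℝ) := by positivity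
      rw [cellPot, ← mul_neg]
      calc _ ≤ weight p.β H h * ((1 + 1 / (H : ℝ)) *
            (bonusScale S A H p * √(m.N h x.1 x.2 : ℝ))) :=
            mul_le_mul_of_nonneg_left (by linarith) hw.le
        _ ≤ _ := mul_le_mul (weight_le _ hh) (mul_le_mul_of_nonneg_right h2 hbs)
            (by positivity) (by positivity)
    rw [← Finset.sum_neg_distrib]
    refine (Finset.sum_le_sum fun x _ => hcell x).trans ?_
    rw [← Finset.mul_sum, ← Finset.mul_sum, ← Finset.mul_sum]
    have := sum_sqrt_le (fun x : S × A => m.N h x.1 x.2) (hk h)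
    gcongr
  refine (Finset.sum_le_card_nsmul _ _ _ hrow).trans (le_of_eq ?_)
  rw [Nat.card_Icc, Nat.add_sub_cancel, nsmul_eq_mul]

end Paths


/-! ### The failure probability and the rate of the potential -/

section Bounds

/-- The sixth power is chosen because x² will be proportional to t: the bound decays like t^{-3} and
stays summable after multiplication by t+1. -/
theorem exp_neg_le {x : ℝ} (hx : 0 < x) : Real.exp (-x) ≤ 720 / x ^ 6 := by
  have h := Real.pow_div_factorial_le_exp x hx.le 6
  have e : ((Nat.factorial 6 : ℕ) : ℝ) = 720 := by norm_num [Nat.factorial]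
  rw [e, div_le_iff₀ (by norm_num)] at h
  rw [Real.exp_neg, inv_eq_one_div, div_le_div_iff₀ (Real.exp_pos x) (by positivity)]
  linarith

/-- The probability that the estimates of a triple with the given slack ever fail to be
optimistic is at most this, as a function of the log factor. -/
def failureBound (H : ℕ) (c B η ι : ℝ) : ℝ :=
  2880 / ((c ^ 2 * η ^ 2 / (4 * B ^ 2 * H)) ^ 3 * ι ^ 3) + 2 * Real.exp (-ι)

open Filter Topology in
theorem tendsto_failureBound (H : ℕ) (c B η : ℝ) :
    Tendsto (failureBound H c B η) atTop (𝓝 0) := by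
  have h1 : Tendsto (fun ι : ℝ => Real.exp (-ι)) atTop (𝓝 0) :=
    Real.tendsto_exp_neg_atTop_nhds_zero
  have h2 : Tendsto (fun ι : ℝ => (ι ^ 3)⁻¹) atTop (𝓝 0) :=
    tendsto_inv_atTop_zero.comp (tendsto_pow_atTop (by norm_num))
  have h3 := (h2.const_mul (2880 / (c ^ 2 * η ^ 2 / (4 * B ^ 2 * H)) ^ 3)).add (h1.const_mul 2)
  simp only [mul_zero, add_zero] at h3
  refine h3.congr fun ι => ?_
  rw [failureBound, div_mul_eq_div_div 2880, div_eq_mul_inv _ (ι ^ 3)]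

theorem bonusRange_pos {H : ℕ} (hH : 1 ≤ H) {β : ℝ} (hβ : β ≠ 0) : 0 < |Real.exp (β * H) - 1| := by
  have hH' : (H : ℝ) ≠ 0 := by exact_mod_cast (by omega : H ≠ 0)
  rw [abs_pos, sub_ne_zero]
  exact fun h => mul_ne_zero hβ hH' (Real.exp_eq_one_iff _ |>.1 h)

variable {S A : Type*} {H : ℕ} [Fintype S] [Fintype A]

/-- The parameter of the exponential potential for the `t`-th visit. -/
def potRate (S A : Type*) [Fintype S] [Fintype A] (H : ℕ) (p : Params) (t : ℕ) : ℝ :=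
  bonus S A H p t * t / (2 * |Real.exp (p.β * H) - 1| ^ 2 * H)

theorem potRate_nonneg {p : Params} (hc : 0 ≤ p.c) (t : ℕ) : 0 ≤ potRate S A H p t := by
  have := bonus_nonneg S A (H := H) hc t
  unfold potRate
  positivity

theorem bonus_sq {p : Params} (hι : 0 ≤ logFactor S A H p.K p.δ) (t : ℕ) :
    bonus S A H p t ^ 2 = p.c ^ 2 * |Real.exp (p.β * H) - 1| ^ 2 *
      (H * logFactor S A H p.K p.δ / t) := by
  rw [bonus, mul_pow, mul_pow, Real.sq_sqrt (by positivity)]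

end Bounds

/-! ### Concentration of the martingale part and of the visits -/

section Probability

variable {S A : Type*} {H : ℕ} [Fintype S] [Fintype A] [Nonempty A]

/-- The differences are centred and uniformly bounded, so each transition needs the same
compensator. The constant u normalises the initial value. -/
theorem hoeffding_drift (M : MDP S A H) (β θ u : ℝ) :
    IsSupermartingale M fun l => ENNReal.ofReal
      (Real.exp (θ * driftSum M β l - l.length * (θ ^ 2 * driftBound β H ^ 2 / 2) - u)) := by
  intro l π h s a hh
  rw [pexp_ofReal _ _ fun _ => (Real.exp_pos _).le]
  refine ENNReal.ofReal_le_ofReal ?_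
  have hd := hoeffding (M.P h s a) (drift M β π h s a) (driftBound_pos β H)
    (fun s' => abs_drift_le M β π hh s a s') (sum_mul_drift M β π h s a) θ
  have e : ∀ s', Real.exp (θ * driftSum M β ((π, h, s, a, s') :: l) -
      ((π, h, s, a, s') :: l).length * (θ ^ 2 * driftBound β H ^ 2 / 2) - u) =
      Real.exp (θ * drift M β π h s a s') *
      Real.exp (θ * driftSum M β l - l.length * (θ ^ 2 * driftBound β H ^ 2 / 2) - u -
        θ ^ 2 * driftBound β H ^ 2 / 2) := by
    intro s'
    rw [← Real.exp_add, driftSum, List.length_cons]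
    congr 1
    push_cast
    ring
  simp only [e, ← mul_assoc, ← Finset.sum_mul]
  refine (mul_le_mul_of_nonneg_right hd (Real.exp_pos _).le).trans (le_of_eq ?_)
  rw [← Real.exp_add]
  congr 1
  ring

variable [DecidableEq S] [DecidableEq A]

/-- The potential, frozen at the `t`-th visit, that controls the triple `(h, s, a)`. -/
def visitPot (M : MDP S A H) (p : Params) (h : ℕ) (s : S) (a : A) (t : ℕ)
    (l : List (Transition S A)) : ℝ :=
  stoppedPot H (bonus S A H p) (slack M p.β h s a) (noise M p.β h s a) t (potRate S A H p t)
    (p.c ^ 2 * logFactor S A H p.K p.δ / 4) (observed h s a l)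

theorem visitPot_nonneg (M : MDP S A H) (p : Params) (h : ℕ) (s : S) (a : A) (t : ℕ)
    (l : List (Transition S A)) : 0 ≤ visitPot M p h s a t l := stoppedPot_nonneg _

theorem visitPot_super (M : MDP S A H) {p : Params} (hH : 1 ≤ H) (hβ : p.β ≠ 0) (hc : 0 ≤ p.c)
    (hι : 0 ≤ logFactor S A H p.K p.δ) (h : ℕ) (s : S) (a : A) {t : ℕ} (ht : 1 ≤ t) :
    IsSupermartingale M fun l => ENNReal.ofReal (visitPot M p h s a t l) := by
  intro l π h₁ s₁ a₁ hh₁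
  rw [pexp_ofReal _ _ fun _ => visitPot_nonneg ..]
  refine ENNReal.ofReal_le_ofReal ?_
  simp only [visitPot, observed]
  split_ifs with e
  · obtain ⟨rfl, rfl, rfl⟩ := e
    have hB := bonusRange_pos hH hβ
    have hH' : (0 : ℝ) < H := by exact_mod_cast hH
    have ht' : (0 : ℝ) < t := by exact_mod_cast ht
    refine stoppedPot_super hH _ hB (abs_noise_le M p.β hh₁ s₁ a₁) (sum_mul_noise M p.β h₁ s₁ a₁)
      (fun j hj hjt => bonus_anti S A hc hι hj hjt) (potRate_nonneg hc t) (le_of_eq ?_) _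
    have hb := bonus_sq (S := S) (A := A) hι t
    -- `potRate` is the maximiser of θ ↦ θb_t - θ²B²H/t. The maximum b_t²t/(4B²H) equals c²ι/4,
    -- independently of t.
    have e1 : potRate S A H p t * bonus S A H p t -
        potRate S A H p t ^ 2 * |Real.exp (p.β * H) - 1| ^ 2 * H / t =
        bonus S A H p t ^ 2 * (t / (4 * |Real.exp (p.β * H) - 1| ^ 2 * H)) := by
      unfold potRate
      field_simp
      ring
    rw [e1, hb]
    field_simp
  · rw [← Finset.sum_mul, sum_toReal, one_mul]

/-- The potential that controls all visits of the triple `(h, s, a)`. -/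
def triplePot (M : MDP S A H) (p : Params) (h : ℕ) (s : S) (a : A)
    (l : List (Transition S A)) : ℝ≥0∞ :=
  if slack M p.β h s a = 0 then 0
  else ∑ t ∈ Finset.Icc 1 p.K, ENNReal.ofReal (visitPot M p h s a t l)

theorem one_le_triplePot (M : MDP S A H) {p : Params} (hc : 0 ≤ p.c) {h : ℕ}
    (hh : h ∈ Finset.Icc 1 H) (s : S) (a : A) {l : List (Transition S A)}
    (hlen : (observed h s a l).length ≤ p.K)
    (hl : ¬ StaysNonneg H (bonus S A H p) (slack M p.β h s a) (noise M p.β h s a)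
      (observed h s a l)) : 1 ≤ triplePot M p h s a l := by
  unfold triplePot
  split_ifs with h0
  · exact absurd (staysNonneg_of_zero h0.ge (bonus_nonneg S A hc) (noise_eq_zero M p.β hh h0) _) hl
  · obtain ⟨t, ht, h1⟩ := exists_one_le_stoppedPot
      (C := p.c ^ 2 * logFactor S A H p.K p.δ / 4) (potRate S A H p) (potRate_nonneg hc) hl
    have ht' : t ∈ Finset.Icc 1 p.K := by
      rw [Finset.mem_Icc] at *
      exact ⟨ht.1, ht.2.trans hlen⟩
    refine le_trans ?_ (Finset.single_le_sum
      (f := fun t => ENNReal.ofReal (visitPot M p h s a t l)) (fun _ _ => zero_le) ht')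
    exact ENNReal.one_le_ofReal.2 h1

theorem triplePot_nil_le (M : MDP S A H) {p : Params} (hH : 1 ≤ H) (hβ : p.β ≠ 0)
    (hc : 4 ≤ p.c) (hι : 0 < logFactor S A H p.K p.δ)
    (hK : (p.K : ℝ) ≤ Real.exp (logFactor S A H p.K p.δ)) {h : ℕ} (hh : h ∈ Finset.Icc 1 H)
    (s : S) (a : A) (h0 : slack M p.β h s a ≠ 0) :
    triplePot M p h s a [] ≤ ENNReal.ofReal (failureBound H p.c |Real.exp (p.β * H) - 1|
      (slack M p.β h s a) (logFactor S A H p.K p.δ)) := by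
  have hη : 0 < slack M p.β h s a := lt_of_le_of_ne (slack_nonneg M p.β hh s a) h0.symm
  have hB := bonusRange_pos hH hβ
  have hH' : (0 : ℝ) < H := by exact_mod_cast hH
  have hc0 : 0 < p.c := by linarith
  rw [triplePot, if_neg h0,
    ← ENNReal.ofReal_sum_of_nonneg fun t _ => visitPot_nonneg ..]
  refine ENNReal.ofReal_le_ofReal ?_
  unfold failureBound
  set ι := logFactor S A H p.K p.δ with hιdef
  set B := |Real.exp (p.β * H) - 1| with hBdef
  set η := slack M p.β h s a with hηdef
  set γ := p.c ^ 2 * η ^ 2 / (4 * B ^ 2 * H) with hγ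
  have hγ0 : 0 < γ := by positivity
  have hterm : ∀ t ∈ Finset.Icc 1 p.K, visitPot M p h s a t [] ≤
      1440 / (γ ^ 3 * ι ^ 3) * ((t : ℝ) ^ 2)⁻¹ + 2 * p.K * Real.exp (-(4 * ι)) := by
    intro t ht
    have ht1 : (1 : ℝ) ≤ t := by exact_mod_cast (Finset.mem_Icc.1 ht).1
    have htK : (t : ℝ) ≤ p.K := by exact_mod_cast (Finset.mem_Icc.1 ht).2
    refine stoppedPot_nil_le.trans ?_
    have hx2 : (potRate S A H p t * η) ^ 2 = γ * ι * t := by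
      rw [mul_pow, potRate, div_pow, mul_pow, bonus_sq hι.le, hγ, ← hιdef, ← hBdef]
      field_simp
      ring
    have hx0 : 0 < potRate S A H p t * η := by
      have h1 := mul_nonneg (potRate_nonneg (S := S) (A := A) (H := H) hc0.le t) hη.le
      refine lt_of_le_of_ne h1 fun h2 => ?_
      rw [← h2] at hx2
      have : 0 < γ * ι * t := by positivity
      simp at hx2
      rcases hx2 with (h3 | h3) | h3 <;> simp_all
    have hx6 : (potRate S A H p t * η) ^ 6 = γ ^ 3 * ι ^ 3 * t ^ 3 := by
      calc _ = ((potRate S A H p t * η) ^ 2) ^ 3 := by ring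
        _ = _ := by rw [hx2]; ring
    have h1 := exp_neg_le hx0
    rw [hx6] at h1
    have h2 : Real.exp (-(p.c ^ 2 * ι / 4)) ≤ Real.exp (-(4 * ι)) := by
      rw [Real.exp_le_exp]
      have : 16 * ι ≤ p.c ^ 2 * ι := mul_le_mul_of_nonneg_right (by nlinarith) hι.le
      linarith
    have h3 : ((t : ℝ) + 1) * Real.exp (-(potRate S A H p t * η)) ≤
        1440 / (γ ^ 3 * ι ^ 3) * ((t : ℝ) ^ 2)⁻¹ := by
      calc _ ≤ (2 * t : ℝ) * (720 / (γ ^ 3 * ι ^ 3 * t ^ 3)) :=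
            mul_le_mul (by linarith) h1 (Real.exp_pos _).le (by positivity)
        _ = _ := by field_simp; ring
    have h4 : ((t : ℝ) + 1) * Real.exp (-(p.c ^ 2 * ι / 4)) ≤
        2 * p.K * Real.exp (-(4 * ι)) :=
      mul_le_mul (by linarith) h2 (Real.exp_pos _).le (by positivity)
    rw [mul_add]
    exact add_le_add h3 h4
  refine (Finset.sum_le_sum hterm).trans ?_
  rw [Finset.sum_add_distrib, ← Finset.mul_sum, Finset.sum_const, Nat.card_Icc,
    Nat.add_sub_cancel, nsmul_eq_mul]
  have hsq : ∑ t ∈ Finset.Icc 1 p.K, ((t : ℝ) ^ 2)⁻¹ ≤ 2 := by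
    have h1 := sum_Ioo_inv_sq_le (α := ℝ) 0 (p.K + 1)
    have : Finset.Icc 1 p.K = Finset.Ioo 0 (p.K + 1) := by
      ext i; simp only [Finset.mem_Icc, Finset.mem_Ioo]; omega
    rw [this]
    simpa using h1
  refine add_le_add ?_ ?_
  · calc _ ≤ 1440 / (γ ^ 3 * ι ^ 3) * 2 := mul_le_mul_of_nonneg_left hsq (by positivity)
      _ = _ := by ring
  · have hK0 : (0 : ℝ) ≤ p.K := Nat.cast_nonneg _
    -- The factor K² comes from summing over t and from t+1 ≤ 2K; it is at most e^{2ι}, and c ≥ 4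
    -- has provided e^{-4ι}.
    calc (p.K : ℝ) * (2 * p.K * Real.exp (-(4 * ι)))
        = 2 * ((p.K : ℝ) * p.K) * Real.exp (-(4 * ι)) := by ring
      _ ≤ 2 * (Real.exp ι * Real.exp ι) * Real.exp (-(4 * ι)) := by gcongr
      _ = 2 * Real.exp (-(2 * ι)) := by
        rw [mul_assoc, ← Real.exp_add, ← Real.exp_add]
        ring_nf
      _ ≤ 2 * Real.exp (-ι) := by
        gcongr
        linarith

end Probability


/-! ### The high-probability bound and the comparison of constants -/

section Final

variable {S A : Type*} {H : ℕ} [Fintype S] [Fintype A] [DecidableEq S] [DecidableEq A] [Nonempty A]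

/-- A bound for the martingale part of the regret, up to a factor `√K`. -/
def fluctuation (β δ : ℝ) (H : ℕ) : ℝ := H * driftBound β H ^ 2 / 2 + Real.log (2 / δ)

/-- A bound for the initial potential. -/
def initialPot (S A : Type*) [Fintype S] [Fintype A] (β : ℝ) (H : ℕ) : ℝ :=
  (H * Fintype.card (S × A) : ℕ) * (stepGain β H ^ (H - 1) * |Real.exp (β * H) - 1|)

/-- A bound for the part of the regret that is due to the bonuses. -/
def bonusCost (S A : Type*) [Fintype S] [Fintype A] (H : ℕ) (p : Params) : ℝ :=
  H * (stepGain p.β H ^ (H - 1) * (2 * (bonusScale S A H p *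
    √((Fintype.card (S × A) : ℝ) * p.K))))

theorem observed_length_le {M : MDP S A H} {p : Params} {m : Memory S A}
    {l : List (Transition S A)} (hm : MemoryInv M p m l) {k : ℕ} (hk : ∀ h, visits m h ≤ k)
    (h : ℕ) (s : S) (a : A) : (observed h s a l).length ≤ k := by
  rw [← hm.N_eq]
  exact (Finset.single_le_sum (f := fun x : S × A => m.N h x.1 x.2) (fun _ _ => Nat.zero_le _)
    (Finset.mem_univ (s, a))).trans (hk h)

theorem triplePot_super (M : MDP S A H) {p : Params} (hH : 1 ≤ H) (hβ : p.β ≠ 0) (hc : 0 ≤ p.c)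
    (hι : 0 ≤ logFactor S A H p.K p.δ) (h : ℕ) (s : S) (a : A) :
    IsSupermartingale M (triplePot M p h s a) := by
  intro l π h₁ s₁ a₁ hh₁
  unfold triplePot
  split_ifs with h0
  · exact (pexp_const _ _).le
  · rw [pexp_sum]
    exact Finset.sum_le_sum fun t ht =>
      visitPot_super M hH hβ hc hι h s a (Finset.mem_Icc.1 ht).1 l π h₁ s₁ a₁ hh₁

theorem one_le_sum_triplePot (M : MDP S A H) {p : Params} (hc : 0 ≤ p.c)
    {l : List (Transition S A)} (hl : ¬ GoodHistory M p l)
    (hlen : ∀ h s a, (observed h s a l).length ≤ p.K) :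
    1 ≤ ∑ x ∈ Finset.Icc 1 H ×ˢ (Finset.univ : Finset (S × A)),
      triplePot M p x.1 x.2.1 x.2.2 l := by
  by_contra! hlt
  refine hl fun h hh s a => ?_
  by_contra hs
  refine absurd (one_le_triplePot M hc hh s a (hlen h s a) hs) (not_le.2 ?_)
  have hmem : (h, s, a) ∈ Finset.Icc 1 H ×ˢ (Finset.univ : Finset (S × A)) :=
    Finset.mem_product.2 ⟨hh, Finset.mem_univ _⟩
  refine lt_of_le_of_lt ?_ hlt
  have := Finset.single_le_sum (f := fun x : ℕ × S × A => triplePot M p x.1 x.2.1 x.2.2 l)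
    (fun _ _ => zero_le) hmem
  exact this

theorem regret_high_probability (M : MDP S A H) {p : Params} (hH : 1 ≤ H) (hβ : p.β ≠ 0)
    (hc : 4 ≤ p.c) (hδ : 0 < p.δ) (hK1 : 1 ≤ p.K) (hι : 0 < logFactor S A H p.K p.δ)
    (hK : (p.K : ℝ) ≤ Real.exp (logFactor S A H p.K p.δ))
    (hfail : ∀ x ∈ Finset.Icc 1 H ×ˢ (Finset.univ : Finset (S × A)),
      slack M p.β x.1 x.2.1 x.2.2 ≠ 0 → (H * Fintype.card (S × A) : ℕ) *
        failureBound H p.c |Real.exp (p.β * H) - 1| (slack M p.β x.1 x.2.1 x.2.2)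
          (logFactor S A H p.K p.δ) ≤ p.δ / 2)
    (env : List (Episode S A) → PMF S) {sel : List (Episode S A) → ℕ → S → (A → ℝ) → A}
    (hsel : ∀ l h s (q : A → ℝ) a, q a ≤ q (sel l h s q)) :
    ENNReal.ofReal (1 - p.δ) ≤ (run M p env sel p.K).toOuterMeasure
      {x | regret M p.β x.2 ≤ invLip p.β H / |p.β| *
        (initialPot S A p.β H + bonusCost S A H p + √(p.K : ℝ) * fluctuation p.β p.δ H)} := by
  have hc0 : 0 ≤ p.c := by linarith
  have hKpos : (0 : ℝ) < p.K := by exact_mod_cast hK1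
  set cells := Finset.Icc 1 H ×ˢ (Finset.univ : Finset (S × A)) with hcells
  have hcard : cells.card = H * Fintype.card (S × A) := by
    rw [hcells, Finset.card_product, Nat.card_Icc, Finset.card_univ, Nat.add_sub_cancel]
  -- With this θ the compensator over all KH transitions is H·`driftBound`²/2, free of K.
  set θ := 1 / √(p.K : ℝ) with hθ
  have hsq : √(p.K : ℝ) ^ 2 = p.K := Real.sq_sqrt hKpos.le
  have hsq0 : 0 < √(p.K : ℝ) := Real.sqrt_pos.2 hKpos
  let Ψ : List (Transition S A) → ℝ≥0∞ := fun l => ENNReal.ofReal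
    (Real.exp (θ * driftSum M p.β l - l.length * (θ ^ 2 * driftBound p.β H ^ 2 / 2) -
      Real.log (2 / p.δ)))
  -- The first part detects a loss of optimism, the second a large martingale; each has mean at most
  -- δ/2.
  let Φ : List (Transition S A) → ℝ≥0∞ := fun l =>
    ∑ x ∈ cells, triplePot M p x.1 x.2.1 x.2.2 l + Ψ l
  refine one_sub_le_toOuterMeasure _ _ (fun x => Φ (history x.2)) hδ.le ?_ ?_
  · intro x hx hbad
    obtain ⟨i1, i2, i3, i4⟩ := run_inv hβ hc0 env hsel p.K x hx
    by_cases hgood : GoodHistory M p (history x.2)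
    · refine le_trans ?_ le_add_self
      refine ENNReal.one_le_ofReal.2 (Real.one_le_exp_iff.2 ?_)
      by_contra! hneg
      refine hbad ((regret_le M hβ _).trans (mul_le_mul_of_nonneg_left ?_ ?_))
      · have h1 := i4 hgood
        have h2 := neg_memoryPot_le hc0 hH i1 hgood i3
        have h3 := memoryPot_init_le M p hH
        have h4 : driftSum M p.β (history x.2) ≤ √(p.K : ℝ) * fluctuation p.β p.δ H := by
          rw [i2] at hneg
          have e : (((p.K * H : ℕ) : ℝ)) * (θ ^ 2 * driftBound p.β H ^ 2 / 2) =
              H * driftBound p.β H ^ 2 / 2 := by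
            rw [hθ, div_pow, hsq]
            push_cast
            field_simp
          rw [e] at hneg
          have h5 : θ * driftSum M p.β (history x.2) < fluctuation p.β p.δ H := by
            unfold fluctuation; linarith
          calc driftSum M p.β (history x.2)
              = √(p.K : ℝ) * (θ * driftSum M p.β (history x.2)) := by
                rw [hθ]; field_simp
            _ ≤ _ := mul_le_mul_of_nonneg_left h5.le hsq0.le
        unfold initialPot bonusCost
        linarith
      · have : 1 ≤ invLip p.β H := le_max_left _ _
        positivity
    · refine le_trans ?_ le_self_add
      exact one_le_sum_triplePot M hc0 hgood (observed_length_le i1 i3)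
  · rw [pexp_add, pexp_sum]
    have hΨ : pexp (run M p env sel p.K) (fun x => Ψ (history x.2)) ≤
        ENNReal.ofReal (p.δ / 2) := by
      refine ((hoeffding_drift M p.β θ _).run p env sel p.K).trans (le_of_eq ?_)
      simp only [driftSum, List.length_nil, Nat.cast_zero, zero_mul, mul_zero, sub_zero, zero_sub]
      rw [Real.exp_neg, Real.exp_log (by positivity), inv_div]
    have hcell : ∀ x ∈ cells, pexp (run M p env sel p.K)
        (fun y => triplePot M p x.1 x.2.1 x.2.2 (history y.2)) ≤
        ENNReal.ofReal (p.δ / 2 / (H * Fintype.card (S × A) : ℕ)) := by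
      intro x hx
      have hx1 := (Finset.mem_product.1 hx).1
      have hN : (0 : ℝ) < (H * Fintype.card (S × A) : ℕ) := by
        rw [← hcard]
        exact_mod_cast Finset.card_pos.2 ⟨x, hx⟩
      have hsup := triplePot_super M hH hβ hc0 hι.le x.1 x.2.1 x.2.2
      by_cases h0 : slack M p.β x.1 x.2.1 x.2.2 = 0
      · simp [triplePot, h0, pexp]
      · refine (hsup.run p env sel p.K).trans
          ((triplePot_nil_le M hH hβ hc hι hK hx1 _ _ h0).trans (ENNReal.ofReal_le_ofReal ?_))
        rw [le_div_iff₀ hN, mul_comm]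
        exact hfail x hx h0
    refine (add_le_add (Finset.sum_le_card_nsmul _ _ _ hcell) hΨ).trans ?_
    rw [hcard, nsmul_eq_mul]
    have h1 : ((H * Fintype.card (S × A) : ℕ) : ℝ≥0∞) *
        ENNReal.ofReal (p.δ / 2 / (H * Fintype.card (S × A) : ℕ)) ≤ ENNReal.ofReal (p.δ / 2) := by
      rw [← ENNReal.ofReal_natCast, ← ENNReal.ofReal_mul (Nat.cast_nonneg _)]
      refine ENNReal.ofReal_le_ofReal ?_
      rcases eq_or_ne ((H * Fintype.card (S × A) : ℕ) : ℝ) 0 with h0 | h0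
      · rw [h0, zero_mul]; positivity
      · exact (mul_div_cancel₀ _ h0).le
    refine (add_le_add_left h1 _).trans (le_of_eq ?_)
    rw [← ENNReal.ofReal_add (by positivity) (by positivity), add_halves]

theorem maxGain_pow (β : ℝ) (H : ℕ) : maxGain β ^ H = max 1 (Real.exp (β * H)) := by
  unfold maxGain
  rcases le_total 0 β with hβ | hβ
  · rw [max_eq_right (Real.one_le_exp hβ), max_eq_right (Real.one_le_exp (by positivity)),
      mul_comm, Real.exp_nat_mul]
  · rw [max_eq_left (Real.exp_le_one_iff.2 hβ), max_eq_left (Real.exp_le_one_iff.2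
      (mul_nonpos_of_nonpos_of_nonneg hβ (Nat.cast_nonneg H))), one_pow]

theorem stepGain_pow_le (β : ℝ) (hH : 1 ≤ H) :
    stepGain β H ^ (H - 1) ≤ 3 * max 1 (Real.exp (β * H)) := by
  have hH' : (0 : ℝ) < H := by exact_mod_cast hH
  have h1 : (1 + 1 / (H : ℝ)) ^ H ≤ 3 := by
    calc (1 + 1 / (H : ℝ)) ^ H ≤ Real.exp (1 / H) ^ H :=
          pow_le_pow_left₀ (by positivity) (by linarith [Real.add_one_le_exp (1 / (H : ℝ))]) H
      _ = Real.exp 1 := by rw [← Real.exp_nat_mul, mul_one_div_cancel hH'.ne']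
      _ ≤ 3 := by linarith [Real.exp_one_lt_d9]
  calc stepGain β H ^ (H - 1) ≤ stepGain β H ^ H :=
        pow_le_pow_right₀ (one_le_stepGain β H) (Nat.sub_le _ _)
    _ = (1 + 1 / (H : ℝ)) ^ H * max 1 (Real.exp (β * H)) := by
        rw [stepGain, mul_pow, maxGain_pow]
    _ ≤ _ := mul_le_mul_of_nonneg_right h1 (by positivity)

/-- Depending on the sign of β, at least one of the first two factors is 1, so the exponential
losses of inverting the transform and of propagating errors do not multiply. -/
theorem invLip_mul_le (β : ℝ) (H : ℕ) :
    invLip β H * max 1 (Real.exp (β * H)) * |Real.exp (β * H) - 1| ≤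
      Real.exp (|β| * H) * (Real.exp (|β| * H) - 1) := by
  unfold invLip
  rcases le_total 0 β with hβ | hβ
  · have h0 : 0 ≤ β * H := by positivity
    have h1 := Real.one_le_exp h0
    rw [abs_of_nonneg hβ, max_eq_right h1, max_eq_left (Real.exp_le_one_iff.2 (by linarith)),
      abs_of_nonneg (by linarith), one_mul]
  · have h0 : β * H ≤ 0 := mul_nonpos_of_nonpos_of_nonneg hβ (Nat.cast_nonneg H)
    have h1 := Real.exp_le_one_iff.2 h0
    have h2 : 1 ≤ Real.exp (-(β * H)) := Real.one_le_exp (by linarith)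
    have hE : Real.exp (-(β * H)) * Real.exp (β * H) = 1 := by rw [← Real.exp_add]; simp
    rw [abs_of_nonpos hβ, max_eq_left h1, max_eq_right h2, abs_of_nonpos (by linarith),
      neg_mul]
    nlinarith

/-- Bernoulli's inequality for (e^{3u})^H, together with e^u(e^u - 1) ≤ e^{3u} - 1. -/
theorem mul_exp_mul_le {u : ℝ} (hu : 0 ≤ u) (H : ℕ) :
    H * (Real.exp u * (Real.exp u - 1)) ≤ Real.exp (3 * (u * H)) - 1 := by
  have hx : 1 ≤ Real.exp u := Real.one_le_exp hu
  have e : Real.exp (3 * (u * H)) = (Real.exp u ^ 3) ^ H := by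
    rw [← Real.exp_nat_mul, ← Real.exp_nat_mul]
    congr 1
    push_cast
    ring
  have hb := one_add_mul_sub_le_pow (a := Real.exp u ^ 3)
    (by linarith [pow_nonneg (zero_le_one.trans hx) 3]) H
  rw [e]
  have h1 : Real.exp u * (Real.exp u - 1) ≤ Real.exp u ^ 3 - 1 := by
    nlinarith [mul_nonneg (sq_nonneg (Real.exp u)) (sub_nonneg.2 hx)]
  have := mul_le_mul_of_nonneg_left h1 (Nat.cast_nonneg (α := ℝ) H)
  linarith

/-- The H² pulled out of the root cancels the H² in the denominator of λ. -/
theorem lam_mul_sqrt (S A : Type*) [Fintype S] [Fintype A] {β : ℝ} (hH : 1 ≤ H) (K : ℕ) (δ : ℝ) :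
    lam (|β| * (H : ℝ) ^ 2) * √((H : ℝ) ^ 4 * Fintype.card S * Fintype.card A * ((K : ℝ) * H)
      * logFactor S A H K δ) = (Real.exp (3 * (|β| * H * H)) - 1) / |β| *
        (√((H : ℝ) * logFactor S A H K δ) * √((Fintype.card (S × A) : ℝ) * K)) := by
  have hH' : (0 : ℝ) < H := by exact_mod_cast hH
  have e : (H : ℝ) ^ 4 * Fintype.card S * Fintype.card A * ((K : ℝ) * H) * logFactor S A H K δ =
      ((H : ℝ) ^ 2) ^ 2 * (((Fintype.card (S × A) : ℝ) * K) * (H * logFactor S A H K δ)) := by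
    rw [Fintype.card_prod]
    push_cast
    ring
  rw [e, Real.sqrt_mul (by positivity), Real.sqrt_sq (by positivity),
    Real.sqrt_mul (by positivity), lam]
  rw [show 3 * (|β| * (H : ℝ) ^ 2) = 3 * (|β| * H * H) by ring]
  field_simp

theorem bonusCost_le (S A : Type*) [Fintype S] [Fintype A] {p : Params} (hH : 1 ≤ H)
    (hc : 0 ≤ p.c) :
    invLip p.β H / |p.β| * bonusCost S A H p ≤ 12 * p.c * (lam (|p.β| * (H : ℝ) ^ 2) *
      √((H : ℝ) ^ 4 * Fintype.card S * Fintype.card A * ((p.K : ℝ) * H)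
        * logFactor S A H p.K p.δ)) := by
  rw [lam_mul_sqrt S A hH]
  have hL : 0 ≤ invLip p.β H := le_trans zero_le_one (le_max_left _ _)
  set R := √((H : ℝ) * logFactor S A H p.K p.δ) * √((Fintype.card (S × A) : ℝ) * p.K) with hR
  set B := |Real.exp (p.β * H) - 1| with hB
  have h1 := stepGain_pow_le p.β hH
  have h2 := invLip_mul_le p.β H
  have h3 := mul_exp_mul_le (u := |p.β| * H) (by positivity) H
  have h4 : H * (invLip p.β H * max 1 (Real.exp (p.β * H)) * B) ≤
      Real.exp (3 * (|p.β| * H * H)) - 1 :=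
    (mul_le_mul_of_nonneg_left h2 (Nat.cast_nonneg H)).trans h3
  calc invLip p.β H / |p.β| * bonusCost S A H p
      = invLip p.β H / |p.β| * (H * (4 * p.c * B * R)) * stepGain p.β H ^ (H - 1) := by
        rw [bonusCost, bonusScale, hR, ← hB]; ring
    _ ≤ invLip p.β H / |p.β| * (H * (4 * p.c * B * R)) * (3 * max 1 (Real.exp (p.β * H))) :=
        mul_le_mul_of_nonneg_left h1 (by positivity)
    _ = 12 * p.c / |p.β| * R * (H * (invLip p.β H * max 1 (Real.exp (p.β * H)) * B)) := by ring
    _ ≤ 12 * p.c / |p.β| * R * (Real.exp (3 * (|p.β| * H * H)) - 1) :=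
        mul_le_mul_of_nonneg_left h4 (by positivity)
    _ = _ := by ring

open Filter in
theorem exists_forall_logFactor_ge (S A : Type*) [Fintype S] [Fintype A] [Nonempty S] [Nonempty A]
    {δ : ℝ} (hδ : 0 < δ) (J : ℝ) :
    ∃ T₀ : ℕ, ∀ K : ℕ, T₀ ≤ K * H → J ≤ logFactor S A H K δ ∧ 1 ≤ K := by
  have hS : (0 : ℝ) < Fintype.card S := by exact_mod_cast Fintype.card_pos
  have hA : (0 : ℝ) < Fintype.card A := by exact_mod_cast Fintype.card_pos
  have h1 : Tendsto (fun T : ℕ => Real.log ((Fintype.card S : ℝ) * Fintype.card A * T / δ))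
      atTop atTop := by
    refine Real.tendsto_log_atTop.comp (Tendsto.atTop_div_const hδ ?_)
    exact Tendsto.const_mul_atTop (by positivity) tendsto_natCast_atTop_atTop
  obtain ⟨N, hN⟩ := eventually_atTop.1 (h1.eventually_ge_atTop J)
  refine ⟨max N 1, fun K hK => ⟨?_, ?_⟩⟩
  · have := hN (K * H) ((le_max_left _ _).trans hK)
    unfold logFactor
    exact_mod_cast this
  · have h2 : 1 ≤ K * H := (le_max_right _ _).trans hK
    exact Nat.pos_of_ne_zero fun h0 => by simp [h0] at h2

theorem natCast_le_exp_logFactor (S A : Type*) [Fintype S] [Fintype A] [Nonempty S] [Nonempty A]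
    (hH : 1 ≤ H) {δ : ℝ} (hδ : 0 < δ) (hδ1 : δ ≤ 1) {K : ℕ} (hK : 1 ≤ K) :
    (K : ℝ) ≤ Real.exp (logFactor S A H K δ) := by
  have hS : (1 : ℝ) ≤ Fintype.card S := by exact_mod_cast Fintype.card_pos
  have hA : (1 : ℝ) ≤ Fintype.card A := by exact_mod_cast Fintype.card_pos
  have hH' : (1 : ℝ) ≤ H := by exact_mod_cast hH
  have hK' : (0 : ℝ) < K := by exact_mod_cast hK
  rw [logFactor, Real.exp_log (by positivity), le_div_iff₀ hδ]
  have h1 : (1 : ℝ) ≤ Fintype.card S * Fintype.card A * H :=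
    one_le_mul_of_one_le_of_one_le (one_le_mul_of_one_le_of_one_le hS hA) hH'
  nlinarith

omit [DecidableEq S] [DecidableEq A] in
open Filter in
/-- For large values of the log factor the estimates stay optimistic with high probability, and the
lower order terms of the regret are negligible. -/
theorem eventually_logFactor (M : MDP S A H) (hH : 1 ≤ H) {β δ c : ℝ} (hβ : β ≠ 0) (hδ : 0 < δ)
    [Nonempty S] :
    ∀ᶠ ι : ℝ in atTop, 0 < ι ∧
      (∀ x ∈ Finset.Icc 1 H ×ˢ (Finset.univ : Finset (S × A)),
        (H * Fintype.card (S × A) : ℕ) * failureBound H c |Real.exp (β * H) - 1|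
          (slack M β x.1 x.2.1 x.2.2) ι ≤ δ / 2) ∧
      invLip β H / |β| * (initialPot S A β H + |fluctuation β δ H|) ≤
        (Real.exp (3 * (|β| * H * H)) - 1) / |β| *
          (√((H : ℝ) * ι) * √(Fintype.card (S × A) : ℝ)) := by
  have hH' : (0 : ℝ) < H := by exact_mod_cast hH
  have hβ' : 0 < |β| := abs_pos.2 hβ
  refine (eventually_gt_atTop 0).and (((Finset.eventually_all _).2 fun x _ => ?_).and ?_)
  · have h1 := (tendsto_failureBound H c |Real.exp (β * H) - 1|
      (slack M β x.1 x.2.1 x.2.2)).const_mul ((H * Fintype.card (S × A) : ℕ) : ℝ)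
    rw [mul_zero] at h1
    exact h1.eventually_le_const (by positivity)
  · have h1 : Tendsto (fun ι : ℝ => √((H : ℝ) * ι)) atTop atTop :=
      Real.tendsto_sqrt_atTop.comp (tendsto_id.const_mul_atTop hH')
    have h2 : 0 < √(Fintype.card (S × A) : ℝ) :=
      Real.sqrt_pos.2 (by exact_mod_cast Fintype.card_pos)
    have h3 : 0 < (Real.exp (3 * (|β| * H * H)) - 1) / |β| := by
      refine div_pos (sub_pos.2 (Real.one_lt_exp_iff.2 (by positivity))) hβ'
    exact ((h1.atTop_mul_const h2).const_mul_atTop h3).eventually_ge_atTop _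

end Final

end RSQ

end

theorem theorem2 :
    ∃ c₀ : ℝ, 0 < c₀ ∧ ∀ c : ℝ, c₀ ≤ c → ∃ C : ℝ, 0 < C ∧
      ∀ (S A : Type*) [Fintype S] [Fintype A] [DecidableEq S] [DecidableEq A] [Nonempty A]
        (H : ℕ), 1 ≤ H →
      ∀ (M : RSQ.MDP S A H) (β : ℝ), β ≠ 0 → ∀ δ : ℝ, 0 < δ → δ ≤ 1 →
      ∃ T₀ : ℕ, ∀ K : ℕ, T₀ ≤ K * H →
      ∀ (env : List (RSQ.Episode S A) → PMF S)
        (sel : List (RSQ.Episode S A) → ℕ → S → (A → ℝ) → A),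
        (∀ l h s (q : A → ℝ) (a : A), q a ≤ q (sel l h s q)) →
        ENNReal.ofReal (1 - δ) ≤
          (RSQ.run M ⟨β, δ, c, K⟩ env sel K).toOuterMeasure
            {x | RSQ.regret M β x.2 ≤
              C * RSQ.lam (|β| * (H : ℝ) ^ 2) *
                √((H : ℝ) ^ 4 * Fintype.card S * Fintype.card A * ((K : ℝ) * H)
                  * RSQ.logFactor S A H K δ)} := by
  -- With c ≥ 4 the exponent c²ι/4 is at least 4ι. In the final constant, 12c pays for the bonuses
  -- and 1 for all lower-order terms.
  refine ⟨4, by norm_num, fun c hc => ⟨12 * c + 1, by linarith, ?_⟩⟩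
  intro S A _ _ _ _ _ H hH M β hβ δ hδ hδ1
  rcases isEmpty_or_nonempty S with hS | hS
  -- There is no probability law on the empty set, hence no environment.
  · exact ⟨0, fun K _ env => (hS.false (env []).support_nonempty.some).elim⟩
  obtain ⟨J, hJ⟩ := Filter.eventually_atTop.1 (RSQ.eventually_logFactor M hH (c := c) hβ hδ)
  obtain ⟨T₀, hT₀⟩ := RSQ.exists_forall_logFactor_ge (H := H) S A hδ J
  refine ⟨T₀, fun K hK env sel hsel => ?_⟩
  obtain ⟨hι, hK1⟩ := hT₀ K hK
  obtain ⟨hι0, hfail, hrest⟩ := hJ _ hι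
  refine (RSQ.regret_high_probability M (p := ⟨β, δ, c, K⟩) hH hβ hc hδ hK1 hι0
    (RSQ.natCast_le_exp_logFactor S A hH hδ hδ1 hK1) (fun x hx _ => hfail x hx) env hsel).trans
    (MeasureTheory.OuterMeasure.mono _ fun x hx => ?_)
  refine (show RSQ.regret M β x.2 ≤ _ from hx).trans ?_
  have hbonus := RSQ.bonusCost_le S A (p := ⟨β, δ, c, K⟩) hH (by linarith)
  have hL : 0 ≤ RSQ.invLip β H / |β| :=
    div_nonneg (zero_le_one.trans (le_max_left _ _)) (abs_nonneg β)
  have hK' : 1 ≤ √(K : ℝ) := Real.one_le_sqrt.2 (by exact_mod_cast hK1)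
  have hP : 0 ≤ RSQ.initialPot S A β H := by
    have := RSQ.one_le_stepGain β H
    unfold RSQ.initialPot
    positivity
  have hlow : RSQ.invLip β H / |β| *
      (RSQ.initialPot S A β H + √(K : ℝ) * RSQ.fluctuation β δ H) ≤
      RSQ.lam (|β| * (H : ℝ) ^ 2) * √((H : ℝ) ^ 4 * Fintype.card S * Fintype.card A *
        ((K : ℝ) * H) * RSQ.logFactor S A H K δ) := by
    rw [RSQ.lam_mul_sqrt S A hH, Real.sqrt_mul (Nat.cast_nonneg (Fintype.card (S × A)))]
    calc _ ≤ RSQ.invLip β H / |β| *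
          (√(K : ℝ) * (RSQ.initialPot S A β H + |RSQ.fluctuation β δ H|)) := by
          refine mul_le_mul_of_nonneg_left ?_ hL
          have := mul_le_mul_of_nonneg_left (le_abs_self (RSQ.fluctuation β δ H))
            (zero_le_one.trans hK')
          nlinarith
      _ = √(K : ℝ) * (RSQ.invLip β H / |β| *
          (RSQ.initialPot S A β H + |RSQ.fluctuation β δ H|)) := by ring
      _ ≤ √(K : ℝ) * _ := mul_le_mul_of_nonneg_left hrest (zero_le_one.trans hK')
      _ = _ := by ring
  rw [mul_assoc]
  simp only at hbonus ⊢
  linarith
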